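/- Let $H:\mathbb R^2\to\mathbb R$ be $C^\infty$, let $\Delta\subset\mathbb R^m$ be compact, and let $P(x,y,\delta)$, $Q(x,y,\delta)$ be $C^\infty$ functions for $(x,y)\in\mathbb R^2$ and $\delta$ in a neighbourhood of $\Delta$. Consider $$\dot x=H_y+\varepsilon P(x,y,\delta),\qquad \dot y=-H_x+\varepsilon Q(x,y,\delta). \tag{1}$$ Suppose that for $\varepsilon=0$ system (1) has a center at $(x_0,y_0)$, $H(x_0,y_0)=h_0$: $(x_0,y_0)$ is a critical point of $H$, and there are $\beta>0$ and periodic orbits $L_h$, $h\in(h_0,h_0+\beta)$, with $H=h$ on $L_h$, which fill a punctured neighbourhood of $(x_0,y_0)$ and shrink to $(x_0,y_0)$ as $h\to h_0$. The Melnikov function of (1) near $(x_0,y_0)$ is $$M(h,\delta)=\oint_{L_h}(H_yQ+H_xP)\,dt=\oint_{L_h}Q\,dx-P\,dy ,$$ where $L_h$ is run through once in the direction of the flow. Let $u=a(x-x_0)+b(y-y_0)$, $v=c(x-x_0)+d(y-y_0)$ with $D=ad-bc\ne0$, and $\tau=kt$ with $k\neq0$. In these variables (1) becomes $\frac{du}{d\tau}=\tilde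 H_v+\varepsilon\tilde P$, $\frac{dv}{d\tau}=-\tilde H_u+\varepsilon\tilde Q$ with $$\tilde H=\tfrac Dk\,(H-h_0),\qquad \tilde P=\tfrac1k(aP+bQ),\qquad \tilde Q=\tfrac1k(cP+dQ).$$ Suppose that $\tilde H$ is in normal form at the origin: for some $\omega>0$ either $\tilde H=\frac\omega2(u^2+v^2)+\sum_{i+j\ge3}h_{ij}u^iv^j$ or $\tilde H=\frac\omega2v^2+\sum_{i+j\ge3}h_{ij}u^iv^j$ (Taylor expansions), and, for the smooth solution $\varphi(u)=O(u^2)$ of $\tilde H_v(u,\varphi(u))=0$ near $u=0$, one has $\tilde H(u,\varphi(u))=\sum_{j\ge2p}h_ju^j$ with $h_{2p}>0$, $p\ge1$. Then the transformed system has a center at the origin, with a family of periodic orbits as above, and there are functions $b_j(\delta)$, $j\ge0$, such that the Melnikov function $\tilde M$ of the transformed system near the origin satisfies $$\tilde M(h,\delta)=h^{\frac{p+1}{2p}}\sum_{j\ge0}b_j(\delta)\,h^{\frac jp},\qquad h>0,$$ and $$M(h,\delta)=(h-h_0)^{\frac{p+1}{2p}}\sum_{j\ge0}\tilde b_j(\delta)\,(h-h_0)^{\frac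 jp},\qquad h>h_0,\qquad \tilde b_j(\delta)=\operatorname{sgn}(k)\Big(\frac Dk\Big)^{\frac{1+2j-p}{2p}}b_j(\delta).$$ In particular, for $p=1$, $$M(h,\delta)=(h-h_0)\sum_{j\ge0}\tilde b_j(\delta)(h-h_0)^j,\qquad \tilde b_j(\delta)=\operatorname{sgn}(k)\Big(\frac Dk\Big)^{j}b_j(\delta).$$ (The hypotheses force $D/k>0$.) The expansions are asymptotic to all orders as $h\to0^+$, respectively $h\to h_0^+$, uniformly for $\delta\in\Delta$: the error of the partial sum over $j<N$ is $O\big((h-h_0)^{\frac{p+1}{2p}+\frac Np}\big)$ (with $h_0$ replaced by $0$ for $\tilde M$). If $H$ is analytic at $(x_0,y_0)$ and $P,Q$ are analytic at $(x_0,y_0,\delta)$ for every $\delta\in\Delta$, then the series converge to $\tilde M$ and $M$ for all $\delta\in\Delta$ and all $h$ in some interval $(0,r)$, respectively $(h_0,h_0+r)$, with $r>0$ independent of $\delta$. -/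

import Mathlib

open Set Filter Topology Asymptotics
open scoped ContDiff

noncomputable section

namespace NearHamiltonian

/-- The partial derivative `∂F/∂x` of a function on the plane. -/
def partialX (F : ℝ × ℝ → ℝ) (z : ℝ × ℝ) : ℝ := fderiv ℝ F z (1, 0)

/-- The partial derivative `∂F/∂y` of a function on the plane. -/
def partialY (F : ℝ × ℝ → ℝ) (z : ℝ × ℝ) : ℝ := fderiv ℝ F z (0, 1)

/-- `γ` is a periodic orbit of `x' = H_y`, `y' = -H_x` on the level `H = h`, with least period
`T > 0` (so `γ` runs exactly once through the closed orbit while `t` runs through `[0, T)`). -/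
structure IsPeriodicOrbit (H : ℝ × ℝ → ℝ) (h : ℝ) (γ : ℝ → ℝ × ℝ) (T : ℝ) : Prop where
  flow : ∀ t, HasDerivAt γ (partialY H (γ t), -partialX H (γ t)) t
  period_pos : 0 < T
  closed : ∀ t, γ (t + T) = γ t
  simple : InjOn γ (Ico 0 T)
  level : ∀ t, H (γ t) = h

/-- A center `z₀` of the Hamiltonian system of `H`, together with its family of periodic orbits
`L_h`, `h ∈ (h₀, h₀ + β)`, where `h₀ = H z₀`: the orbit `L_h` lies on the level `H = h`, it shrinks
to `z₀` as `h → h₀`, and the orbits fill a punctured neighbourhood of `z₀`. -/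
structure CenterFamily (H : ℝ × ℝ → ℝ) (z₀ : ℝ × ℝ) where
  critical : fderiv ℝ H z₀ = 0
  β : ℝ
  β_pos : 0 < β
  orbit : ℝ → ℝ → ℝ × ℝ
  period : ℝ → ℝ
  isPeriodicOrbit : ∀ h ∈ Ioo (H z₀) (H z₀ + β), IsPeriodicOrbit H h (orbit h) (period h)
  shrinks : ∀ U ∈ 𝓝 z₀, ∀ᶠ h in 𝓝[>] (H z₀), range (orbit h) ⊆ U
  fills : insert z₀ (⋃ h ∈ Ioo (H z₀) (H z₀ + β), range (orbit h)) ∈ 𝓝 z₀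

/-- The Melnikov function `M(h, δ) = ∮_{L_h} (H_y q + H_x p) dt = ∮_{L_h} q dx - p dy` of the system
`x' = H_y + ε p`, `y' = -H_x + ε q` near the center `z₀`. -/
def CenterFamily.melnikov {E : Type*} {H : ℝ × ℝ → ℝ} {z₀ : ℝ × ℝ} (L : CenterFamily H z₀)
    (P Q : ℝ × ℝ → E → ℝ) (h : ℝ) (δ : E) : ℝ :=
  ∫ t in (0 : ℝ)..L.period h,
    (partialY H (L.orbit h t) * Q (L.orbit h t) δ + partialX H (L.orbit h t) * P (L.orbit h t) δ)

/-- The normal form of an elementary center: `H = (κ/2) (x² + y²) + (terms of order ≥ 3)`. -/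
def IsElementaryForm (H : ℝ × ℝ → ℝ) (κ : ℝ) : Prop :=
  (fun z : ℝ × ℝ => H z - κ / 2 * (z.1 ^ 2 + z.2 ^ 2)) =O[𝓝 0] fun z => ‖z‖ ^ 3

/-- The normal form of a nilpotent critical point: `H = (κ/2) y² + (terms of order ≥ 3)`. -/
def IsNilpotentForm (H : ℝ × ℝ → ℝ) (κ : ℝ) : Prop :=
  (fun z : ℝ × ℝ => H z - κ / 2 * z.2 ^ 2) =O[𝓝 0] fun z => ‖z‖ ^ 3

/-- With `φ(x) = O(x²)` the smooth solution of `H_y(x, φ(x)) = 0` near `x = 0`, the expansion of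
`H(x, φ(x))` at `0` starts with a term `c x^{2p}`, where `c > 0`. -/
def HasCenterOrder (H : ℝ × ℝ → ℝ) (p : ℕ) : Prop :=
  ∃ φ : ℝ → ℝ, ContDiffAt ℝ ∞ φ 0 ∧ φ =O[𝓝 0] (fun x => x ^ 2) ∧
    (∀ᶠ x in 𝓝 (0 : ℝ), partialY H (x, φ x) = 0) ∧
    ∃ c : ℝ, 0 < c ∧
      (fun x => H (x, φ x) - c * x ^ (2 * p)) =O[𝓝 0] fun x => x ^ (2 * p + 1)

/-- `H` is in the normal form of an elementary center (`p = 1`) or of a nilpotent center of order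
`p - 1` (`p ≥ 2`) at the origin. -/
def IsCenterNormalForm (H : ℝ × ℝ → ℝ) (p : ℕ) : Prop :=
  (∃ κ : ℝ, 0 < κ ∧ (IsElementaryForm H κ ∨ IsNilpotentForm H κ)) ∧ HasCenterOrder H p

/-- The inverse of the linear change of variables
`u = a (x - x₀) + b (y - y₀)`, `v = c (x - x₀) + d (y - y₀)`. -/
def oldCoords (a b c d x₀ y₀ : ℝ) (w : ℝ × ℝ) : ℝ × ℝ :=
  (x₀ + 1 / (a * d - b * c) * (d * w.1 - b * w.2),
    y₀ + 1 / (a * d - b * c) * (-c * w.1 + a * w.2))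

/-- The Hamiltonian in the variables `(u, v)` and the time `τ = k t`. -/
def newH (a b c d k x₀ y₀ : ℝ) (H : ℝ × ℝ → ℝ) (w : ℝ × ℝ) : ℝ :=
  (a * d - b * c) / k * (H (oldCoords a b c d x₀ y₀ w) - H (x₀, y₀))

/-- The first component of the perturbation in the variables `(u, v)` and the time `τ = k t`. -/
def newP {E : Type*} (a b c d k x₀ y₀ : ℝ) (P Q : ℝ × ℝ → E → ℝ) (w : ℝ × ℝ) (δ : E) : ℝ :=
  1 / k * (a * P (oldCoords a b c d x₀ y₀ w) δ + b * Q (oldCoords a b c d x₀ y₀ w) δ)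

/-- The second component of the perturbation in the variables `(u, v)` and the time `τ = k t`. -/
def newQ {E : Type*} (a b c d k x₀ y₀ : ℝ) (P Q : ℝ × ℝ → E → ℝ) (w : ℝ × ℝ) (δ : E) : ℝ :=
  1 / k * (c * P (oldCoords a b c d x₀ y₀ w) δ + d * Q (oldCoords a b c d x₀ y₀ w) δ)

/-- `M(h, δ) = lead(h - h₀) ∑_{j ≥ 0} b_j(δ) e_j(h - h₀)` as an asymptotic expansion to all orders
for `h → h₀+`, uniformly for `δ ∈ Δ`. -/
def IsAsymptoticExpansion {E : Type*} (lead : ℝ → ℝ) (e : ℕ → ℝ → ℝ) (h₀ : ℝ) (Δ : Set E)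
    (M : ℝ → E → ℝ) (b : ℕ → E → ℝ) : Prop :=
  ∀ N : ℕ, ∃ C r : ℝ, 0 < r ∧ ∀ δ ∈ Δ, ∀ h ∈ Ioo h₀ (h₀ + r),
    |M h δ - lead (h - h₀) * ∑ j ∈ Finset.range N, b j δ * e j (h - h₀)|
      ≤ C * (lead (h - h₀) * e N (h - h₀))

/-- `M(h, δ) = lead(h - h₀) ∑_{j ≥ 0} b_j(δ) e_j(h - h₀)` as a convergent series, for all
`h > h₀` near `h₀` and all `δ ∈ Δ`. -/
def IsConvergentExpansion {E : Type*} (lead : ℝ → ℝ) (e : ℕ → ℝ → ℝ) (h₀ : ℝ) (Δ : Set E)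
    (M : ℝ → E → ℝ) (b : ℕ → E → ℝ) : Prop :=
  ∃ r : ℝ, 0 < r ∧ ∀ δ ∈ Δ, ∀ h ∈ Ioo h₀ (h₀ + r), ∃ S : ℝ,
    HasSum (fun j => b j δ * e j (h - h₀)) S ∧ M h δ = lead (h - h₀) * S

/-- The expansion `M(h, δ) = lead(h - h₀) ∑_{j ≥ 0} b_j(δ) e_j(h - h₀)`: asymptotic in general,
and convergent if the system is analytic. -/
def IsExpansion {E : Type*} (analytic : Prop) (lead : ℝ → ℝ) (e : ℕ → ℝ → ℝ) (h₀ : ℝ) (Δ : Set E)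
    (M : ℝ → E → ℝ) (b : ℕ → E → ℝ) : Prop :=
  IsAsymptoticExpansion lead e h₀ Δ M b ∧
    (analytic → IsConvergentExpansion lead e h₀ Δ M b)

/-- The functions `H`, `p`, `q` are real analytic near the point `z₀`, for all `δ ∈ Δ`. -/
def IsAnalyticSystem {E : Type*} [NormedAddCommGroup E] [NormedSpace ℝ E] (H : ℝ × ℝ → ℝ)
    (P Q : ℝ × ℝ → E → ℝ) (z₀ : ℝ × ℝ) (Δ : Set E) : Prop :=
  AnalyticAt ℝ H z₀ ∧ ∀ δ ∈ Δ,
    AnalyticAt ℝ (fun w : (ℝ × ℝ) × E => P w.1 w.2) (z₀, δ) ∧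
    AnalyticAt ℝ (fun w : (ℝ × ℝ) × E => Q w.1 w.2) (z₀, δ)

end NearHamiltonian

end

/-! Write `F` for the transformed Hamiltonian. In suitable coordinates `F` is `X^{2p} + Y²`, its
orbits are explicit curves, and `ρ = h^{1/(2p)}` can be scaled out of the Melnikov integral.

Since `F_vv(0) = κ > 0`, applying Hadamard's lemma twice gives `F(u, v) = F(u, φ(u)) + (v - φ(u))²
G(u, v)` with `G(0) = κ/2`, while `F(u, φ(u)) = u^{2p} (c + u q(u))`. Taking roots yields `X(u)` and
`Y(u, v)` (`exists_normal_coordinates`). As `u' = F_v` has the sign of `Y`, the orbit on the level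
`ρ^{2p}` consists of one arc with `Y < 0` and one with `Y > 0`, joining the points `X = ±ρ`, `Y = 0`
(`exists_arcs`).

The form `Q du - P dv` differs from some `K du` by an exact form, and `K du = f(X, Y) dX`. With `X =
ρ s` and `r = √(1 - s^{2p})` the Melnikov function is therefore `ρ ∫_{-1}^{1} (f(ρ s, ρ^p r) - f(ρ
s, -ρ^p r)) ds`. The integrand is odd in its second argument, so it is `ρ^p r` times a smooth
function, and the whole is `ρ^{p+1} S(ρ, δ)` (`exists_melnikov_eq`). The root `r` is not smooth in
`s`, but it enters only through the variable of integration, so `S` is as regular as the system. The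
substitution `s ↦ -s` shows that `S` is even in `ρ`. Its Taylor series contains only `ρ^{2j} =
h^{j/p}`, which is the claimed expansion (`isExpansion_of_even`); compactness of `Δ` makes it
uniform.

The linear change of variables gives `M(h) = sgn(k) (D/k)⁻¹ M̃((D/k)(h - h₀))`
(`CenterFamily.melnikov_transform`), and rescaling the series produces the powers of `D/k`
(`IsExpansion.rescale`). The smooth and the analytic case run in parallel, with a regularity `n`
equal to `∞` or `ω`. -/

noncomputable section

namespace NearHamiltonian

/-! ### Regularity of integrals depending on a parameter. -/

section ParametricIntegral

open MeasureTheory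

variable {E Y G : Type*} [NormedAddCommGroup E] [NormedSpace ℝ E]
  [NormedAddCommGroup Y] [NormedSpace ℝ Y] [NormedAddCommGroup G] [NormedSpace ℝ G]

/-- A property that holds locally around a compact arc `{x₀} × σ([a, b])` holds uniformly. -/
theorem eventually_forall_arc {E Y : Type*} [TopologicalSpace E] [TopologicalSpace Y] {a b : ℝ}
    {σ : ℝ → Y} (hσ : Continuous σ) {x₀ : E} {p : E × Y → Prop}
    (h : ∀ s ∈ Icc a b, ∀ᶠ z in 𝓝 (x₀, σ s), p z) :
    ∀ᶠ x in 𝓝 x₀, ∀ s ∈ Icc a b, p (x, σ s) := by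
  refine isCompact_Icc.eventually_forall_of_forall_eventually (P := fun x s => p (x, σ s)) ?_
  intro s hs
  have : Tendsto (fun z : E × ℝ => (z.1, σ z.2)) (𝓝 (x₀, s)) (𝓝 (x₀, σ s)) :=
    (continuous_fst.prodMk (hσ.comp continuous_snd)).tendsto (x₀, s)
  exact this.eventually (h s hs)

theorem continuousOn_arc {E Y G : Type*} [TopologicalSpace E] [TopologicalSpace Y]
    [TopologicalSpace G] {a b : ℝ} {σ : ℝ → Y} (hσ : Continuous σ) {x : E} {f : E × Y → G}
    (h : ∀ s ∈ Icc a b, ContinuousAt f (x, σ s)) :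
    ContinuousOn (fun s => f (x, σ s)) (Icc a b) := fun s hs =>
  (ContinuousAt.comp (f := fun s => (x, σ s)) (h s hs)
    (continuous_const.prodMk hσ).continuousAt).continuousWithinAt

theorem exists_bound_arc {E Y G : Type*} [TopologicalSpace E] [TopologicalSpace Y]
    [SeminormedAddCommGroup G] {a b : ℝ} {σ : ℝ → Y} (hσ : Continuous σ) {x₀ : E} {f : E × Y → G}
    (h : ∀ s ∈ Icc a b, ContinuousAt f (x₀, σ s)) :
    ∃ C, ∀ᶠ x in 𝓝 x₀, ∀ s ∈ Icc a b, ‖f (x, σ s)‖ ≤ C := by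
  obtain ⟨C, hC⟩ := isCompact_Icc.exists_bound_of_continuousOn (continuousOn_arc hσ h)
  refine ⟨C + 1, eventually_forall_arc (p := fun z => ‖f z‖ ≤ C + 1) hσ fun s hs => ?_⟩
  have h1 : ‖f (x₀, σ s)‖ < C + 1 := (hC s hs).trans_lt (lt_add_one C)
  exact ((h s hs).norm.eventually (gt_mem_nhds h1)).mono fun z hz => le_of_lt hz

theorem aestronglyMeasurable_arc {E Y G : Type*} [TopologicalSpace E] [TopologicalSpace Y]
    [SeminormedAddCommGroup G] {a b : ℝ} (hab : a ≤ b) {σ : ℝ → Y} (hσ : Continuous σ) {x : E}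
    {f : E × Y → G} (h : ∀ s ∈ Icc a b, ContinuousAt f (x, σ s)) :
    AEStronglyMeasurable (fun s => f (x, σ s)) (volume.restrict (uIoc a b)) := by
  rw [uIoc_of_le hab]
  exact ((continuousOn_arc hσ h).mono Ioc_subset_Icc_self).aestronglyMeasurable measurableSet_Ioc

theorem continuousAt_integral_arc {E Y G : Type*} [NormedAddCommGroup E] [NormedAddCommGroup Y]
    [NormedAddCommGroup G] [NormedSpace ℝ G] {a b : ℝ} (hab : a ≤ b) {σ : ℝ → Y}
    (hσ : Continuous σ) {x₀ : E} {f : E × Y → G} (h : ∀ s ∈ Icc a b, ∀ᶠ z in 𝓝 (x₀, σ s), ContinuousAt f z) :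
    ContinuousAt (fun x => ∫ s in a..b, f (x, σ s)) x₀ := by
  obtain ⟨C, hC⟩ := exists_bound_arc hσ fun s hs => (h s hs).self_of_nhds
  refine intervalIntegral.continuousAt_of_dominated_interval (bound := fun _ => C) ?_ ?_ ?_ ?_
  · filter_upwards [eventually_forall_arc hσ h] with x hx
    exact aestronglyMeasurable_arc hab hσ hx
  · filter_upwards [hC] with x hx
    refine Eventually.of_forall fun t ht => hx t ?_
    rw [uIoc_of_le hab] at ht
    exact Ioc_subset_Icc_self ht
  · exact intervalIntegrable_const
  · refine Eventually.of_forall fun t ht => ?_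
    rw [uIoc_of_le hab] at ht
    exact ContinuousAt.comp (f := fun x => (x, σ t)) (h t (Ioc_subset_Icc_self ht)).self_of_nhds
      (continuous_id.prodMk continuous_const).continuousAt

/-- Differentiation under the integral sign: compactness of the arc bounds the partial derivative by
one constant near `x₀`, and this constant is the dominating function. -/
theorem hasFDerivAt_integral_arc {a b : ℝ} (hab : a ≤ b) {σ : ℝ → Y} (hσ : Continuous σ) {x₀ : E}
    {f : E × Y → G} (h : ∀ s ∈ Icc a b, ContDiffAt ℝ 1 f (x₀, σ s)) :
    HasFDerivAt (fun x => ∫ s in a..b, f (x, σ s))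
      (∫ s in a..b, (fderiv ℝ f (x₀, σ s)).comp (ContinuousLinearMap.inl ℝ E Y)) x₀ := by
  have hev := eventually_forall_arc hσ fun s hs => (h s hs).eventually (by simp)
  have hc : ∀ z, ContDiffAt ℝ 1 f z →
      ContinuousAt (fun z => (fderiv ℝ f z).comp (ContinuousLinearMap.inl ℝ E Y)) z := fun z hz =>
    (hz.continuousAt_fderiv (by simp)).clm_comp continuousAt_const
  obtain ⟨C, hC⟩ := exists_bound_arc hσ fun s hs => hc _ (h s hs)
  have hall := hev.and hC
  refine intervalIntegral.hasFDerivAt_integral_of_dominated_of_fderiv_le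
    (bound := fun _ => C) (s := {x | (∀ s ∈ Icc a b, ContDiffAt ℝ 1 f (x, σ s)) ∧
      ∀ s ∈ Icc a b, ‖(fderiv ℝ f (x, σ s)).comp (ContinuousLinearMap.inl ℝ E Y)‖ ≤ C})
    (F' := fun x s => (fderiv ℝ f (x, σ s)).comp (ContinuousLinearMap.inl ℝ E Y))
    hall ?_ ?_ ?_ ?_ ?_ ?_
  · filter_upwards [hev] with x hx
    exact aestronglyMeasurable_arc hab hσ fun s hs => (hx s hs).continuousAt
  · exact (continuousOn_arc hσ fun s hs => (h s hs).continuousAt).intervalIntegrable_of_Icc hab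
  · exact aestronglyMeasurable_arc hab hσ fun s hs => hc _ (h s hs)
  · refine Eventually.of_forall fun t ht x hx => hx.2 t ?_
    rw [uIoc_of_le hab] at ht
    exact Ioc_subset_Icc_self ht
  · exact intervalIntegrable_const
  · refine Eventually.of_forall fun t ht x hx => ?_
    rw [uIoc_of_le hab] at ht
    have h1 := ((hx.1 t (Ioc_subset_Icc_self ht)).differentiableAt (by simp)).hasFDerivAt
    exact h1.comp x (hasFDerivAt_prodMk_left x (σ t))

end ParametricIntegral

section

open MeasureTheory

variable {E Y : Type} [NormedAddCommGroup E] [NormedSpace ℝ E]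
  [NormedAddCommGroup Y] [NormedSpace ℝ Y]

/-- Each step of the induction replaces `f` by its partial derivative, with values in `E →L[ℝ] G`.
The statement is therefore proved for all target spaces at once, in one universe. -/
theorem contDiffAt_nat_integral_arc {a b : ℝ} (hab : a ≤ b) {σ : ℝ → Y} (hσ : Continuous σ)
    {x₀ : E} (m : ℕ) {G : Type} [NormedAddCommGroup G] [NormedSpace ℝ G] {f : E × Y → G}
    (h : ∀ s ∈ Icc a b, ContDiffAt ℝ m f (x₀, σ s)) :
    ContDiffAt ℝ m (fun x => ∫ s in a..b, f (x, σ s)) x₀ := by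
  induction m generalizing G with
  | zero =>
    have h0 : ∀ᶠ x in 𝓝 x₀, ∀ s ∈ Icc a b, ∀ᶠ z in 𝓝 (x, σ s), ContinuousAt f z := by
      refine eventually_forall_arc (p := fun z => ∀ᶠ z' in 𝓝 z, ContinuousAt f z') hσ fun s hs => ?_
      exact (((h s hs).eventually (by simp)).mono fun z hz => hz.continuousAt).eventually_nhds
    have h1 : ∀ᶠ x in 𝓝 x₀, ContinuousAt (fun x => ∫ s in a..b, f (x, σ s)) x :=
      h0.mono fun x hx => continuousAt_integral_arc hab hσ hx
    exact contDiffAt_zero.2 ⟨_, h1, fun x hx => ContinuousAt.continuousWithinAt hx⟩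
  | succ m ih =>
    have h' : ∀ s ∈ Icc a b, ContDiffAt ℝ (m + 1) f (x₀, σ s) := fun s hs => by
      simpa using h s hs
    push_cast
    refine contDiffAt_succ_iff_hasFDerivAt.2
      ⟨fun x => ∫ s in a..b, (fderiv ℝ f (x, σ s)).comp (ContinuousLinearMap.inl ℝ E Y), ?_, ?_⟩
    · refine ⟨_, eventually_forall_arc (p := fun z => ContDiffAt ℝ 1 f z) hσ fun s hs => ?_,
        fun x hx => hasFDerivAt_integral_arc hab hσ hx⟩
      exact ((h' s hs).of_le (by simp)).eventually (by simp)
    · refine ih (f := fun z => (fderiv ℝ f z).comp (ContinuousLinearMap.inl ℝ E Y)) fun s hs => ?_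
      exact ((h' s hs).fderiv_right le_rfl).clm_comp contDiffAt_const

end

section

open MeasureTheory
open scoped NNReal ENNReal

variable {E Y G : Type*} [NormedAddCommGroup E] [NormedSpace ℝ E]
  [NormedAddCommGroup Y] [NormedSpace ℝ Y] [NormedAddCommGroup G] [NormedSpace ℝ G]
  [CompleteSpace G]

/-- Integrating a power series in both variables over a small piece of the parameter arc gives a
power series. -/
theorem analyticAt_setIntegral_of_hasFPowerSeriesOnBall {σ : ℝ → Y} (hσ : Continuous σ) {x₀ : E}
    {y₀ : Y} {f : E × Y → G} {p : FormalMultilinearSeries ℝ (E × Y) G} {r : ℝ≥0∞}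
    (hf : HasFPowerSeriesOnBall f p (x₀, y₀) r) {r₀ : ℝ≥0} (h0 : 0 < r₀)
    (hr : (r₀ : ℝ≥0∞) + r₀ < r) {K : Set ℝ} (hKm : MeasurableSet K) (hK : volume K < ⊤)
    (hσK : ∀ s ∈ K, ‖σ s - y₀‖₊ ≤ r₀) :
    AnalyticAt ℝ (fun x => ∫ s in K, f (x, σ s)) x₀ := by
  have : IsFiniteMeasure (volume.restrict K) := ⟨by simpa using hK⟩
  let ι : E →L[ℝ] E × Y := ContinuousLinearMap.inl ℝ E Y
  let w : ℝ → E × Y := fun s => (0, σ s - y₀)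
  have hw : ∀ s ∈ K, ‖w s‖₊ ≤ r₀ := fun s hs => by
    simpa [w, Prod.nnnorm_def] using hσK s hs
  have hrad : (r₀ : ℝ≥0∞) + r₀ < p.radius := hr.trans_le hf.r_le
  have hrad1 : (r₀ : ℝ≥0∞) < p.radius := (le_self_add).trans_lt hrad
  have hrr : (r₀ : ℝ≥0∞) < r := (le_self_add).trans_lt hr
  have hwr : ∀ s ∈ K, (‖w s‖₊ : ℝ≥0∞) < p.radius := fun s hs =>
    (ENNReal.coe_le_coe.2 (hw s hs)).trans_lt hrad1
  let q : ℝ → FormalMultilinearSeries ℝ E G := fun s =>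
    (p.changeOrigin (w s)).compContinuousLinearMap ι
  -- A bound for the `k`-th coefficient of the series recentred at any shift of size at most `r₀`.
  -- One `r₀` in `r₀ + r₀ < r` pays for the shift, the other is the radius of the resulting series
  -- in `x`, so `∑ B k * r₀ ^ k` converges and allows termwise integration.
  let B : ℕ → ℝ≥0 := fun k =>
    ∑' s : Σ l : ℕ, { s : Finset (Fin (k + l)) // s.card = l }, ‖p (k + s.1)‖₊ * r₀ ^ s.1
  have hBsum : Summable fun k => B k * r₀ ^ k := by
    simpa only [B, ← NNReal.tsum_mul_right] using
      (NNReal.summable_sigma.1 (p.changeOriginSeries_summable_aux₁ hrad)).2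
  have hι : ‖ι‖ ≤ 1 := ContinuousLinearMap.opNorm_le_bound _ zero_le_one fun x => by
    simp [ι, Prod.norm_def]
  have hqB : ∀ s ∈ K, ∀ k, ‖q s k‖ ≤ B k := by
    intro s hs k
    have h1 : ‖p.changeOrigin (w s) k‖₊ ≤ B k := by
      refine (p.nnnorm_changeOrigin_le k (hwr s hs)).trans ?_
      refine Summable.tsum_le_tsum (fun i => ?_)
        (p.changeOriginSeries_summable_aux₂ (hwr s hs) k)
        (p.changeOriginSeries_summable_aux₂ hrad1 k)
      gcongr
      exact hw s hs
    calc ‖q s k‖ ≤ ‖p.changeOrigin (w s) k‖ * ‖ι‖ ^ k :=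
          FormalMultilinearSeries.norm_compContinuousLinearMap_le _ _ _
      _ ≤ ‖p.changeOrigin (w s) k‖ * 1 := by
          gcongr
          exact pow_le_one₀ (norm_nonneg _) hι
      _ ≤ B k := by simpa using (NNReal.coe_le_coe.2 h1)
  have hqm : ∀ k, AEStronglyMeasurable (fun s => q s k) (volume.restrict K) := by
    intro k
    refine ContinuousOn.aestronglyMeasurable ?_ hKm
    have h1 : ContinuousOn (fun s => p.changeOrigin (w s) k) K := by
      have h2 := (p.hasFPowerSeriesOnBall_changeOrigin k hrad1.pos).continuousOn
      refine h2.comp (by fun_prop) fun s hs => ?_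
      simpa [mem_eball_zero_iff, enorm_eq_nnnorm] using hwr s hs
    exact (ContinuousMultilinearMap.compContinuousLinearMapL (𝕜 := ℝ) (F := G)
      (fun _ : Fin k => ι)).continuous.comp_continuousOn h1
  have hqi : ∀ k, Integrable (fun s => q s k) (volume.restrict K) := fun k =>
    Integrable.of_bound (hqm k) (B k) ((ae_restrict_iff' hKm).2 (Eventually.of_forall
      fun s hs => hqB s hs k))
  let Q : FormalMultilinearSeries ℝ E G := fun k => ∫ s in K, q s k
  have hQ : HasFPowerSeriesOnBall (fun x => ∫ s in K, f (x, σ s)) Q x₀ r₀ := by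
    refine ⟨?_, by simpa using h0, ?_⟩
    · refine FormalMultilinearSeries.le_radius_of_summable _ ?_
      have h2 : Summable fun k => (volume.restrict K).real univ * ((B k : ℝ) * (r₀ : ℝ) ^ k) :=
        (by exact_mod_cast hBsum : Summable fun k => (B k : ℝ) * (r₀ : ℝ) ^ k).mul_left _
      refine Summable.of_nonneg_of_le (fun k => by positivity) (fun k => ?_) h2
      have h3 : ‖Q k‖ ≤ B k * (volume.restrict K).real univ :=
        norm_integral_le_of_norm_le_const ((ae_restrict_iff' hKm).2 (Eventually.of_forall
          fun s hs => hqB s hs k))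
      calc ‖Q k‖ * (r₀ : ℝ) ^ k ≤ (B k * (volume.restrict K).real univ) * (r₀ : ℝ) ^ k := by gcongr
        _ = _ := by ring
    · intro x hx
      have hx' : ‖x‖₊ < r₀ := by
        simpa [← NNReal.coe_lt_coe] using hx
      have h4 : ∀ k, Q k (fun _ => x) = ∫ s in K, q s k (fun _ => x) := fun k =>
        ContinuousMultilinearMap.integral_apply (hqi k) _
      simp only [h4]
      refine hasSum_integral_of_dominated_convergence (fun k _ => (B k : ℝ) * (r₀ : ℝ) ^ k)
        (fun k => ?_) (fun k => ?_) ?_ ?_ ?_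
      · exact ((ContinuousMultilinearMap.apply ℝ (fun _ : Fin k => E) G
          (fun _ => x)).continuous.comp_aestronglyMeasurable (hqm k))
      · refine (ae_restrict_iff' hKm).2 (Eventually.of_forall fun s hs => ?_)
        refine ((q s k).le_opNorm _).trans ?_
        simp only [Finset.prod_const, Finset.card_univ, Fintype.card_fin]
        have : ‖x‖ ≤ r₀ := le_of_lt (by exact_mod_cast hx')
        gcongr
        exact hqB s hs k
      · exact Eventually.of_forall fun s => by exact_mod_cast hBsum
      · exact integrable_const _
      · refine (ae_restrict_iff' hKm).2 (Eventually.of_forall fun s hs => ?_)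
        have h5 := hf.changeOrigin (y := w s)
          ((ENNReal.coe_le_coe.2 (hw s hs)).trans_lt hrr)
        have h6 : ((x, 0) : E × Y) ∈ Metric.eball (0 : E × Y) (r - ‖w s‖₊) := by
          rw [mem_eball_zero_iff, lt_tsub_iff_right]
          have : ‖((x, 0) : E × Y)‖ₑ = (‖x‖₊ : ℝ≥0∞) := by
            simp [enorm_eq_nnnorm, Prod.nnnorm_def]
          rw [this]
          refine lt_of_le_of_lt ?_ hr
          exact add_le_add (ENNReal.coe_le_coe.2 hx'.le) (ENNReal.coe_le_coe.2 (hw s hs))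
        have h7 := h5.hasSum h6
        have h8 : ((x₀, y₀) : E × Y) + w s + (x, 0) = (x₀ + x, σ s) := by
          simp [w]
        rw [h8] at h7
        exact h7
  exact hQ.analyticAt

theorem analyticAt_integral_arc {a b : ℝ} (hab : a ≤ b) {σ : ℝ → Y} (hσ : Continuous σ) {x₀ : E}
    {f : E × Y → G} (h : ∀ s ∈ Icc a b, AnalyticAt ℝ f (x₀, σ s)) :
    AnalyticAt ℝ (fun x => ∫ s in a..b, f (x, σ s)) x₀ := by
  have hcont : ∀ᶠ x in 𝓝 x₀, IntegrableOn (fun s => f (x, σ s)) (Icc a b) := by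
    have := eventually_forall_arc (p := fun z => ContinuousAt f z) hσ fun s hs =>
      (h s hs).eventually_continuousAt
    filter_upwards [this] with x hx
    exact (continuousOn_arc hσ hx).integrableOn_Icc
  -- Quantifying over all measurable `K ⊆ S` makes the property stable under unions: `K` splits into
  -- `K ∩ S` and `K \ S`. Compactness then reduces the claim to short pieces, on each of which a
  -- single power series is available.
  have key : ∃ S, MeasurableSet S ∧ Icc a b ⊆ S ∧ ∀ K, MeasurableSet K → K ⊆ S → K ⊆ Icc a b →
      AnalyticAt ℝ (fun x => ∫ s in K, f (x, σ s)) x₀ := by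
    refine isCompact_Icc.induction_on (p := fun A => ∃ S, MeasurableSet S ∧ A ⊆ S ∧
      ∀ K, MeasurableSet K → K ⊆ S → K ⊆ Icc a b →
        AnalyticAt ℝ (fun x => ∫ s in K, f (x, σ s)) x₀) ?_ ?_ ?_ ?_
    · refine ⟨∅, MeasurableSet.empty, Subset.rfl, fun K _ hK _ => ?_⟩
      rw [subset_empty_iff.1 hK]
      simpa using analyticAt_const
    · rintro A A' hA ⟨S, hS, hAS, hK⟩
      exact ⟨S, hS, hA.trans hAS, hK⟩
    · rintro A A' ⟨S, hS, hAS, hK⟩ ⟨S', hS', hAS', hK'⟩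
      refine ⟨S ∪ S', hS.union hS', union_subset_union hAS hAS', fun K hKm hKS hKI => ?_⟩
      have h1 := hK (K ∩ S) (hKm.inter hS) inter_subset_right (inter_subset_left.trans hKI)
      have h2 := hK' (K \ S) (hKm.diff hS) (fun s hs => (hKS hs.1).resolve_left hs.2)
        (sdiff_subset.trans hKI)
      refine (h1.add h2).congr ?_
      filter_upwards [hcont] with x hx
      exact integral_inter_add_sdiff hS (hx.mono_set hKI)
    · intro s hs
      obtain ⟨p, r, hr⟩ := h s hs
      obtain ⟨r₁, hr₁, hr₁r⟩ := ENNReal.lt_iff_exists_nnreal_btwn.1 hr.r_pos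
      have hr₁' : 0 < r₁ := by exact_mod_cast hr₁
      let S := {t | ‖σ t - σ s‖₊ < r₁ / 2}
      have hSo : IsOpen S := isOpen_lt (by fun_prop) continuous_const
      refine ⟨S, mem_nhdsWithin_of_mem_nhds (hSo.mem_nhds (by simpa [S] using hr₁')), S,
        hSo.measurableSet, Subset.rfl, fun K hKm hKS hKI => ?_⟩
      refine analyticAt_setIntegral_of_hasFPowerSeriesOnBall hσ hr (half_pos hr₁') ?_ hKm
        ((measure_mono hKI).trans_lt (by simp)) fun t ht => (hKS ht).le
      rw [← ENNReal.coe_add, add_halves]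
      exact hr₁r
  obtain ⟨S, _, hS, hK⟩ := key
  have := hK (Ioc a b) measurableSet_Ioc (Ioc_subset_Icc_self.trans hS) Ioc_subset_Icc_self
  simpa only [intervalIntegral.integral_of_le hab] using this

end

/-- Smoothness (`n = ∞`) and analyticity (`n = ω`) of integrals depending on a parameter. -/
theorem contDiffAt_integral_arc {E Y G : Type} [NormedAddCommGroup E] [NormedSpace ℝ E]
    [NormedAddCommGroup Y] [NormedSpace ℝ Y] [NormedAddCommGroup G] [NormedSpace ℝ G]
    [CompleteSpace G] {n : WithTop ℕ∞} (hn : n = ∞ ∨ n = ω) {a b : ℝ} (hab : a ≤ b) {σ : ℝ → Y}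
    (hσ : Continuous σ) {x₀ : E} {f : E × Y → G}
    (h : ∀ s ∈ Icc a b, ContDiffAt ℝ n f (x₀, σ s)) :
    ContDiffAt ℝ n (fun x => ∫ s in a..b, f (x, σ s)) x₀ := by
  rcases hn with rfl | rfl
  · exact contDiffAt_infty.2 fun m => contDiffAt_nat_integral_arc hab hσ m fun s hs =>
      contDiffAt_infty.1 (h s hs) m
  · exact (analyticAt_integral_arc hab hσ fun s hs => (h s hs).analyticAt).contDiffAt

/-! ### Hadamard's lemma: division by a power of a variable. -/

section Hadamard

variable {E : Type} [NormedAddCommGroup E] [NormedSpace ℝ E]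

/-- Differentiation loses no regularity in these two classes, so both are treated by the same
argument. -/
theorem add_one_le_of_infty_or_omega {n : WithTop ℕ∞} (hn : n = ∞ ∨ n = ω) : n + 1 ≤ n := by
  rcases hn with rfl | rfl
  · exact le_of_eq rfl
  · exact le_top

theorem one_le_of_infty_or_omega {n : WithTop ℕ∞} (hn : n = ∞ ∨ n = ω) : 1 ≤ n :=
  le_add_self.trans (add_one_le_of_infty_or_omega hn)

theorem ne_zero_of_infty_or_omega {n : WithTop ℕ∞} (hn : n = ∞ ∨ n = ω) : n ≠ 0 := by
  rcases hn with rfl | rfl <;> simp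

/-- A partial derivative of a smooth function is smooth. -/
theorem contDiffAt_deriv_snd {n : WithTop ℕ∞} (hn : n = ∞ ∨ n = ω) {h : E × ℝ → ℝ} {z : E × ℝ}
    (hh : ContDiffAt ℝ n h z) : ContDiffAt ℝ n (fun z => deriv (fun y => h (z.1, y)) z.2) z := by
  have h1 : ContDiffAt ℝ n (fun w : E × ℝ => fderiv ℝ (fun y => h (w.1, y)) w.2) z := by
    refine ContDiffAt.fderiv (n := n) (f := fun (w : E × ℝ) y => h (w.1, y)) (g := fun w => w.2)
      ?_ contDiffAt_snd (add_one_le_of_infty_or_omega hn)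
    exact ContDiffAt.comp (g := h) (z, z.2) hh
      ((contDiffAt_fst.comp _ contDiffAt_fst).prodMk contDiffAt_snd)
  have h2 := h1.clm_apply (contDiffAt_const (c := (1 : ℝ)))
  simpa only [fderiv_apply_one_eq_deriv] using h2

/-- The quotient `h(x, y) / y` of a function that vanishes for `y = 0`, in Hadamard's form. -/
def hadamardQuotient {E : Type} (h : E × ℝ → ℝ) (z : E × ℝ) : ℝ :=
  ∫ t in (0 : ℝ)..1, deriv (fun y => h (z.1, y)) (t * z.2)

theorem hadamardQuotient_zero {E : Type} (h : E × ℝ → ℝ) (x : E) :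
    hadamardQuotient h (x, 0) = deriv (fun y => h (x, y)) 0 := by
  simp [hadamardQuotient]

/-- At `y = 0` all arguments `(x₀, t * 0)` of the integrand coincide, so regularity of `h` at the
single point `(x₀, 0)` suffices. -/
theorem contDiffAt_hadamardQuotient {n : WithTop ℕ∞} (hn : n = ∞ ∨ n = ω) {h : E × ℝ → ℝ} {x₀ : E}
    (hh : ContDiffAt ℝ n h (x₀, 0)) : ContDiffAt ℝ n (hadamardQuotient h) (x₀, 0) := by
  refine contDiffAt_integral_arc (σ := id) hn zero_le_one continuous_id (x₀ := (x₀, (0 : ℝ)))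
    (f := fun w : (E × ℝ) × ℝ => deriv (fun y => h (w.1.1, y)) (w.2 * w.1.2)) fun s _ => ?_
  refine ContDiffAt.comp (f := fun w : (E × ℝ) × ℝ => (w.1.1, w.2 * w.1.2))
    (g := fun z : E × ℝ => deriv (fun y => h (z.1, y)) z.2) ((x₀, (0 : ℝ)), id s) ?_ ?_
  · simpa using contDiffAt_deriv_snd hn hh
  · fun_prop

/-- The fundamental theorem of calculus for `t ↦ h (x, t * y)` on `[0, 1]`. -/
theorem eventually_eq_mul_hadamardQuotient {h : E × ℝ → ℝ} {x₀ : E}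
    (hh : ContDiffAt ℝ 1 h (x₀, 0)) (h0 : ∀ᶠ x in 𝓝 x₀, h (x, 0) = 0) :
    ∀ᶠ z in 𝓝 ((x₀, 0) : E × ℝ), h z = z.2 * hadamardQuotient h z := by
  have h1 : ∀ᶠ z in 𝓝 ((x₀, 0) : E × ℝ), ∀ t ∈ Icc (0 : ℝ) 1,
      ContDiffAt ℝ 1 h (z.1, t * z.2) := by
    refine eventually_forall_arc (σ := id) (p := fun w : (E × ℝ) × ℝ =>
      ContDiffAt ℝ 1 h (w.1.1, w.2 * w.1.2)) continuous_id fun t _ => ?_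
    have hc : Tendsto (fun w : (E × ℝ) × ℝ => (w.1.1, w.2 * w.1.2)) (𝓝 ((x₀, (0 : ℝ)), id t))
        (𝓝 (x₀, 0)) := by
      have : Continuous (fun w : (E × ℝ) × ℝ => (w.1.1, w.2 * w.1.2)) := by fun_prop
      simpa using this.tendsto ((x₀, (0 : ℝ)), id t)
    exact hc.eventually (hh.eventually (by simp))
  have h2 : ∀ᶠ z in 𝓝 ((x₀, 0) : E × ℝ), h (z.1, 0) = 0 :=
    (continuous_fst.tendsto ((x₀, 0) : E × ℝ)).eventually h0
  filter_upwards [h1, h2] with z hz hz0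
  obtain ⟨x, w⟩ := z
  simp only at hz hz0
  have hd : ∀ t ∈ Icc (0 : ℝ) 1, HasDerivAt (fun y => h (x, y)) (deriv (fun y => h (x, y)) (t * w))
      (t * w) := fun t ht => by
    have : DifferentiableAt ℝ (fun y => h (x, y)) (t * w) :=
      ((hz t ht).differentiableAt (by simp)).comp (t * w)
        (DifferentiableAt.prodMk (differentiableAt_const x) differentiableAt_id)
    exact this.hasDerivAt
  have hd2 : ∀ t ∈ uIcc (0 : ℝ) 1, HasDerivAt (fun t => h (x, t * w))
      (deriv (fun y => h (x, y)) (t * w) * w) t := fun t ht => by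
    rw [uIcc_of_le zero_le_one] at ht
    exact (hd t ht).comp t (hasDerivAt_mul_const w)
  have hc : ContinuousOn (fun t => deriv (fun y => h (x, y)) (t * w)) (Icc 0 1) := by
    intro t ht
    have h3 := (hz t ht).continuousAt_fderiv (by simp)
    have h4 : ContinuousAt (fun t : ℝ => fderiv ℝ h (x, t * w) (0, 1)) t :=
      (ContinuousAt.comp (f := fun t : ℝ => (x, t * w)) h3 (by fun_prop)).clm_apply
        continuousAt_const
    refine h4.continuousWithinAt.congr (fun s hs => ?_) ?_
    · have h5 := ((hz s hs).differentiableAt (by simp)).hasFDerivAt.comp_hasDerivAt (s * w)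
        ((hasDerivAt_const (s * w) x).prodMk (hasDerivAt_id (s * w)))
      exact h5.deriv
    · have h5 := ((hz t ht).differentiableAt (by simp)).hasFDerivAt.comp_hasDerivAt (t * w)
        ((hasDerivAt_const (t * w) x).prodMk (hasDerivAt_id (t * w)))
      exact h5.deriv
  have h6 := intervalIntegral.integral_eq_sub_of_hasDerivAt hd2
    ((hc.mul continuousOn_const).intervalIntegrable_of_Icc zero_le_one)
  rw [intervalIntegral.integral_mul_const] at h6
  simp only [one_mul, zero_mul, hz0, sub_zero] at h6
  rw [← h6, mul_comm]
  rfl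

/-- A smooth function of one variable that is `O(x^j)` is `x^j` times a smooth function. -/
theorem exists_eq_pow_mul {n : WithTop ℕ∞} (hn : n = ∞ ∨ n = ω) (j : ℕ) {f : ℝ → ℝ}
    (hf : ContDiffAt ℝ n f 0) (hO : f =O[𝓝 0] fun x => x ^ j) :
    ∃ g : ℝ → ℝ, ContDiffAt ℝ n g 0 ∧ ∀ᶠ x in 𝓝 0, f x = x ^ j * g x := by
  induction j generalizing f with
  | zero => exact ⟨f, hf, by simp⟩
  | succ j ih =>
    let h : ℝ × ℝ → ℝ := fun z => f z.2
    have hh : ContDiffAt ℝ n h (0, 0) := ContDiffAt.comp (0, 0) hf contDiffAt_snd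
    have hf0 : f 0 = 0 := by
      simpa using (isBigO_iff.1 hO).choose_spec.self_of_nhds
    let g : ℝ → ℝ := fun x => hadamardQuotient h (0, x)
    have hg : ContDiffAt ℝ n g 0 :=
      ContDiffAt.comp (g := hadamardQuotient h) (0 : ℝ) (contDiffAt_hadamardQuotient hn hh)
        (contDiffAt_const.prodMk contDiffAt_id)
    have hfg : ∀ᶠ x in 𝓝 (0 : ℝ), f x = x * g x := by
      have h1 := eventually_eq_mul_hadamardQuotient (hh.of_le (one_le_of_infty_or_omega hn))
        (Eventually.of_forall fun _ => hf0)
      have h2 : Tendsto (fun x : ℝ => ((0 : ℝ), x)) (𝓝 0) (𝓝 (0, 0)) :=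
        (Continuous.prodMk continuous_const continuous_id).tendsto 0
      exact h2.eventually h1
    have hgO : g =O[𝓝 0] fun x => x ^ j := by
      obtain ⟨C, hC⟩ := isBigO_iff.1 hO
      -- Away from `0` one factor `x` is cancelled; the bound at `0` itself follows by continuity.
      have h3 : ∀ᶠ x in 𝓝[≠] (0 : ℝ), ‖g x‖ ≤ C * ‖x ^ j‖ := by
        filter_upwards [mem_nhdsWithin_of_mem_nhds hC, mem_nhdsWithin_of_mem_nhds hfg,
          self_mem_nhdsWithin] with x h1 h2 h3
        rw [h2, norm_mul, pow_succ', norm_mul] at h1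
        have hx : 0 < ‖x‖ := norm_pos_iff.2 h3
        nlinarith
      have h4 : ‖g 0‖ ≤ C * ‖(0 : ℝ) ^ j‖ := by
        refine le_of_tendsto_of_tendsto (b := 𝓝[≠] (0 : ℝ))
          (hg.continuousAt.norm.tendsto.mono_left nhdsWithin_le_nhds)
          ((Continuous.tendsto (f := fun x : ℝ => C * ‖x ^ j‖) (by fun_prop) 0).mono_left
            nhdsWithin_le_nhds) h3
      refine isBigO_iff.2 ⟨C, ?_⟩
      rw [eventually_nhdsWithin_iff] at h3
      filter_upwards [h3] with x hx
      rcases eq_or_ne x 0 with rfl | h0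
      · exact h4
      · exact hx h0
    obtain ⟨q, hq, hqe⟩ := ih hg hgO
    refine ⟨q, hq, ?_⟩
    filter_upwards [hqe, hfg] with x h1 h2
    rw [h2, h1]
    ring

end Hadamard

/-! ### Coordinates in which the Hamiltonian is `X^{2p} + Y²`. -/

/-- The inverse function theorem for maps `(u, v) ↦ (f u, g (u, v))` of the plane. -/
theorem exists_triangular_inverse {n : WithTop ℕ∞} (hn : n ≠ 0) {f : ℝ → ℝ} {g : ℝ × ℝ → ℝ}
    (hf : ContDiffAt ℝ n f 0) (hg : ContDiffAt ℝ n g 0) (hf0 : f 0 = 0) (hg0 : g 0 = 0)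
    (hf' : deriv f 0 ≠ 0) (hg' : fderiv ℝ g 0 (0, 1) ≠ 0) :
    ∃ Φ : ℝ × ℝ → ℝ × ℝ, ContDiffAt ℝ n Φ 0 ∧ ∀ᶠ z in 𝓝 (0 : ℝ × ℝ), Φ (f z.1, g z) = z := by
  let α := deriv f 0
  let β := fderiv ℝ g 0 (1, 0)
  let γ := fderiv ℝ g 0 (0, 1)
  let A : ℝ × ℝ →L[ℝ] ℝ × ℝ :=
    (α • ContinuousLinearMap.fst ℝ ℝ ℝ).prod (fderiv ℝ g 0)
  let A' : ℝ × ℝ →L[ℝ] ℝ × ℝ :=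
    (α⁻¹ • ContinuousLinearMap.fst ℝ ℝ ℝ).prod
      (γ⁻¹ • (ContinuousLinearMap.snd ℝ ℝ ℝ - (β * α⁻¹) • ContinuousLinearMap.fst ℝ ℝ ℝ))
  have hlin : ∀ a b : ℝ, fderiv ℝ g 0 (a, b) = a * β + b * γ := fun a b => by
    have : ((a, b) : ℝ × ℝ) = a • (1, 0) + b • (0, 1) := by simp
    rw [this, map_add, map_smul, map_smul]
    rfl
  have hα : α ≠ 0 := hf'
  have hγ : γ ≠ 0 := hg'
  let e : (ℝ × ℝ) ≃L[ℝ] ℝ × ℝ := ContinuousLinearEquiv.equivOfInverse A A'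
    (fun z => by
      obtain ⟨a, b⟩ := z
      ext
      · simp [A, A', hα]
      · simp only [ContinuousLinearMap.prod_apply, A, A', hlin]
        simp
        field_simp
        ring)
    (fun z => by
      obtain ⟨a, b⟩ := z
      ext
      · simp [A, A', hα]
      · simp only [ContinuousLinearMap.prod_apply, A, A', hlin]
        simp
        field_simp
        ring)
  let Ψ : ℝ × ℝ → ℝ × ℝ := fun z => (f z.1, g z)
  have hΨ : ContDiffAt ℝ n Ψ 0 := (ContDiffAt.comp (g := f) (0 : ℝ × ℝ) hf contDiffAt_fst).prodMk hg
  have hΨ' : HasFDerivAt Ψ (e : ℝ × ℝ →L[ℝ] ℝ × ℝ) 0 := by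
    have h1 : HasFDerivAt (fun z : ℝ × ℝ => f z.1) (α • ContinuousLinearMap.fst ℝ ℝ ℝ) 0 :=
      HasDerivAt.comp_hasFDerivAt (0 : ℝ × ℝ) (h₂ := f) (hf.differentiableAt hn).hasDerivAt
        hasFDerivAt_fst
    exact h1.prodMk (hg.differentiableAt hn).hasFDerivAt
  have hΨ0 : Ψ 0 = 0 := by simp [Ψ, hf0, hg0]
  refine ⟨hΨ.localInverse hΨ' hn, ?_, ?_⟩
  · have := hΨ.to_localInverse hΨ' hn
    rwa [hΨ0] at this
  · exact (hΨ.hasStrictFDerivAt' hΨ' hn).eventually_left_inverse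

theorem hasDerivAt_partialY {G : ℝ × ℝ → ℝ} {z : ℝ × ℝ} (h : DifferentiableAt ℝ G z) :
    HasDerivAt (fun v => G (z.1, v)) (partialY G z) z.2 :=
  HasFDerivAt.comp_hasDerivAt (l := G) z.2 (f := fun v => (z.1, v)) h.hasFDerivAt
    ((hasDerivAt_const z.2 z.1).prodMk (hasDerivAt_id z.2))

theorem hasDerivAt_partialX {G : ℝ × ℝ → ℝ} {z : ℝ × ℝ} (h : DifferentiableAt ℝ G z) :
    HasDerivAt (fun u => G (u, z.2)) (partialX G z) z.1 :=
  HasFDerivAt.comp_hasDerivAt (l := G) z.1 (f := fun u => (u, z.2)) h.hasFDerivAt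
    ((hasDerivAt_id z.1).prodMk (hasDerivAt_const z.1 z.2))

theorem contDiffAt_partialY {n : WithTop ℕ∞} (hn : n = ∞ ∨ n = ω) {G : ℝ × ℝ → ℝ} {z : ℝ × ℝ}
    (h : ContDiffAt ℝ n G z) : ContDiffAt ℝ n (partialY G) z :=
  (h.fderiv_right (add_one_le_of_infty_or_omega hn)).clm_apply contDiffAt_const

/-- A function on the plane with `F(0, v) = (κ/2) v² + O(v³)` satisfies `F_vv(0, 0) = κ`. -/
theorem partialY_partialY_eq {n : WithTop ℕ∞} (hn : n = ∞ ∨ n = ω) {F : ℝ × ℝ → ℝ}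
    (hF : ContDiffAt ℝ n F 0) {κ : ℝ}
    (hFv : (fun v : ℝ => F (0, v) - κ / 2 * v ^ 2) =O[𝓝 0] fun v => v ^ 3) :
    partialY (partialY F) 0 = κ := by
  have h1n := one_le_of_infty_or_omega hn
  have hn0 := ne_zero_of_infty_or_omega hn
  have hι : Tendsto (fun v : ℝ => ((0 : ℝ), v)) (𝓝 0) (𝓝 0) :=
    (Continuous.prodMk continuous_const continuous_id).tendsto 0
  have hFι : ContDiffAt ℝ n (fun v : ℝ => F (0, v)) 0 :=
    ContDiffAt.comp (g := F) (0 : ℝ) hF (contDiffAt_const.prodMk contDiffAt_id)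
  obtain ⟨q, hq, hqe⟩ := exists_eq_pow_mul hn 3 (f := fun v : ℝ => F (0, v) - κ / 2 * v ^ 2)
    (hFι.sub (by fun_prop)) hFv
  have hqd : ∀ᶠ v in 𝓝 (0 : ℝ), DifferentiableAt ℝ q v :=
    ((hq.of_le h1n).eventually (by simp)).mono fun v hv => hv.differentiableAt (by simp)
  have hFd : ∀ᶠ z in 𝓝 (0 : ℝ × ℝ), DifferentiableAt ℝ F z :=
    ((hF.of_le h1n).eventually (by simp)).mono fun v hv => hv.differentiableAt (by simp)
  have h1 : (fun v : ℝ => partialY F (0, v)) =ᶠ[𝓝 0]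
      fun v => κ * v + (3 * v ^ 2 * q v + v ^ 3 * deriv q v) := by
    filter_upwards [hqd, hι.eventually hFd, hqe.eventually_nhds] with v h2 h3 h4
    have h5 := hasDerivAt_partialY h3
    have h6 : HasDerivAt (fun v : ℝ => κ / 2 * v ^ 2 + v ^ 3 * q v)
        (κ / 2 * (2 * v) + (3 * v ^ 2 * q v + v ^ 3 * deriv q v)) v := by
      have h7 := ((hasDerivAt_pow 2 v).const_mul (κ / 2)).add
        ((hasDerivAt_pow 3 v).mul h2.hasDerivAt)
      exact h7.congr_deriv (by norm_num)
    have h8 : (fun v : ℝ => F (0, v)) =ᶠ[𝓝 v] fun v => κ / 2 * v ^ 2 + v ^ 3 * q v := by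
      filter_upwards [h4] with w hw
      linarith
    rw [h5.unique (h6.congr_of_eventuallyEq h8)]
    ring
  have hdq : DifferentiableAt ℝ (deriv q) 0 := by
    have h2 : ContDiffAt ℝ n (fun v => fderiv ℝ q v 1) 0 :=
      (hq.fderiv_right (add_one_le_of_infty_or_omega hn)).clm_apply contDiffAt_const
    exact h2.differentiableAt hn0
  have h2 : HasDerivAt (fun v : ℝ => κ * v + (3 * v ^ 2 * q v + v ^ 3 * deriv q v)) κ 0 := by
    have h3 := ((hasDerivAt_id (0 : ℝ)).const_mul κ).add
      ((((hasDerivAt_pow 2 (0 : ℝ)).const_mul 3).mul (hq.differentiableAt hn0).hasDerivAt).add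
        ((hasDerivAt_pow 3 (0 : ℝ)).mul hdq.hasDerivAt))
    exact h3.congr_deriv (by simp)
  have h3 := hasDerivAt_partialY ((contDiffAt_partialY hn hF).differentiableAt hn0)
  exact h3.unique (h2.congr_of_eventuallyEq h1)

/-- The solution `φ` of `F_v(u, φ(u)) = 0` inherits the regularity of `F`. -/
theorem contDiffAt_of_partialY_eq_zero {n : WithTop ℕ∞} (hn : n = ∞ ∨ n = ω) {F : ℝ × ℝ → ℝ}
    (hF : ContDiffAt ℝ n F 0) (hF2 : partialY (partialY F) 0 ≠ 0) {φ : ℝ → ℝ}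
    (hφ : ContinuousAt φ 0) (hφ0 : φ 0 = 0) (h : ∀ᶠ u in 𝓝 (0 : ℝ), partialY F (u, φ u) = 0) :
    ContDiffAt ℝ n φ 0 := by
  have h0 : partialY F 0 = 0 := by
    have := h.self_of_nhds
    rw [hφ0] at this
    exact this
  -- The map `(u, v) ↦ (u, F_v(u, v))` is locally invertible, and its inverse sends `(u, 0)` to `(u,
  -- φ(u))`. In the analytic case this upgrades `φ`, which is only assumed smooth.
  obtain ⟨Θ, hΘ, hΘe⟩ := exists_triangular_inverse (ne_zero_of_infty_or_omega hn) (f := id)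
    contDiffAt_id (contDiffAt_partialY hn hF) rfl h0 (by simp) hF2
  have ht : Tendsto (fun u : ℝ => (u, φ u)) (𝓝 0) (𝓝 (0 : ℝ × ℝ)) := by
    have := (continuousAt_id.prodMk hφ).tendsto (x := (0 : ℝ))
    simpa [hφ0, Prod.mk_zero_zero] using this
  have h1 : φ =ᶠ[𝓝 0] fun u => (Θ (u, 0)).2 := by
    filter_upwards [ht.eventually hΘe, h] with u h2 h3
    rw [h3] at h2
    exact (congrArg Prod.snd h2).symm
  refine ContDiffAt.congr_of_eventuallyEq ?_ h1
  exact contDiffAt_snd.comp _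
    (ContDiffAt.comp (g := Θ) (0 : ℝ) hΘ (contDiffAt_id.prodMk contDiffAt_const))

/-- `F(u, v) - F(u, φ(u)) = (v - φ(u))² G(u, v)` with a smooth `G`. -/
theorem exists_eq_sq_mul {n : WithTop ℕ∞} (hn : n = ∞ ∨ n = ω) {F : ℝ × ℝ → ℝ}
    (hF : ContDiffAt ℝ n F 0) {φ : ℝ → ℝ} (hφ : ContDiffAt ℝ n φ 0) (hφ0 : φ 0 = 0)
    (h : ∀ᶠ u in 𝓝 (0 : ℝ), partialY F (u, φ u) = 0) :
    ∃ G : ℝ × ℝ → ℝ, ContDiffAt ℝ n G 0 ∧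
      ∀ᶠ z in 𝓝 (0 : ℝ × ℝ), F z = F (z.1, φ z.1) + (z.2 - φ z.1) ^ 2 * G z := by
  have h1n := one_le_of_infty_or_omega hn
  -- Straightening the curve `v = φ(u)` to `y = 0`: there both `f` and `f_y` vanish, so Hadamard's
  -- quotient can be taken twice.
  let f : ℝ × ℝ → ℝ := fun z => F (z.1, φ z.1 + z.2) - F (z.1, φ z.1)
  have hφ1 : ContDiffAt ℝ n (fun z : ℝ × ℝ => φ z.1) 0 :=
    ContDiffAt.comp (g := φ) (0 : ℝ × ℝ) hφ contDiffAt_fst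
  have hf : ContDiffAt ℝ n f (0, 0) := by
    refine ContDiffAt.sub ?_ ?_
    · refine ContDiffAt.comp (g := F) (f := fun z : ℝ × ℝ => (z.1, φ z.1 + z.2)) (0, 0) ?_ ?_
      · simpa [hφ0, Prod.mk_zero_zero] using hF
      · exact contDiffAt_fst.prodMk (hφ1.add contDiffAt_snd)
    · refine ContDiffAt.comp (g := F) (f := fun z : ℝ × ℝ => (z.1, φ z.1)) (0, 0) ?_ ?_
      · simpa [hφ0, Prod.mk_zero_zero] using hF
      · exact contDiffAt_fst.prodMk hφ1
  have hf1 := contDiffAt_hadamardQuotient hn hf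
  have e1 := eventually_eq_mul_hadamardQuotient (hf.of_le h1n)
    (Eventually.of_forall fun u => by simp [f])
  have hFd : ∀ᶠ z in 𝓝 (0 : ℝ × ℝ), DifferentiableAt ℝ F z :=
    ((hF.of_le h1n).eventually (by simp)).mono fun v hv => hv.differentiableAt (by simp)
  have ht : Tendsto (fun u : ℝ => (u, φ u)) (𝓝 0) (𝓝 (0 : ℝ × ℝ)) := by
    have := (continuousAt_id.prodMk hφ.continuousAt).tendsto (x := (0 : ℝ))
    simpa [hφ0, Prod.mk_zero_zero] using this
  have e2 := eventually_eq_mul_hadamardQuotient (hf1.of_le h1n) (by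
    filter_upwards [h, ht.eventually hFd] with u h2 h3
    rw [hadamardQuotient_zero]
    have h4 := hasDerivAt_partialY h3
    rw [h2] at h4
    have h5 : HasDerivAt (fun y => F (u, φ u + y)) 0 0 := by
      have := HasDerivAt.comp_const_add (φ u) 0 (f := fun v => F (u, v)) (f' := 0) (by simpa using h4)
      exact this
    exact (h5.sub_const (F (u, φ u))).deriv)
  let s : ℝ × ℝ → ℝ × ℝ := fun z => (z.1, z.2 - φ z.1)
  have hs : ContDiffAt ℝ n s 0 := contDiffAt_fst.prodMk (contDiffAt_snd.sub hφ1)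
  have hs0 : s 0 = (0, 0) := by simp [s, hφ0]
  have hst : Tendsto s (𝓝 0) (𝓝 (0, 0)) := by
    have := hs.continuousAt.tendsto
    rwa [hs0] at this
  refine ⟨fun z => hadamardQuotient (hadamardQuotient f) (s z), ?_, ?_⟩
  · refine ContDiffAt.comp (g := hadamardQuotient (hadamardQuotient f)) (0 : ℝ × ℝ) ?_ hs
    rw [hs0]
    exact contDiffAt_hadamardQuotient hn hf1
  · filter_upwards [hst.eventually e1, hst.eventually e2] with z h2 h3
    rw [h3] at h2
    have h4 : f (s z) = F z - F (z.1, φ z.1) := by simp [f, s]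
    rw [h4] at h2
    have h5 : (s z).2 = z.2 - φ z.1 := rfl
    rw [h5] at h2
    linear_combination h2

theorem sign_mul_pos {a b : ℝ} (hb : 0 < b) : SignType.sign (a * b) = SignType.sign a := by
  rw [sign_mul, sign_pos hb, mul_one]

/-- Coordinates `(X, Y)` in which the Hamiltonian of a center becomes `X^{2p} + Y²`. -/
theorem exists_normal_coordinates {n : WithTop ℕ∞} (hn : n = ∞ ∨ n = ω) {F : ℝ × ℝ → ℝ}
    (hF : ContDiffAt ℝ n F 0) {κ : ℝ} (hκ : 0 < κ)
    (hFv : (fun v : ℝ => F (0, v) - κ / 2 * v ^ 2) =O[𝓝 0] fun v => v ^ 3) {p : ℕ} (hp : 1 ≤ p)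
    (hord : HasCenterOrder F p) :
    ∃ (X : ℝ → ℝ) (Y : ℝ × ℝ → ℝ) (Φ : ℝ × ℝ → ℝ × ℝ),
      ContDiffAt ℝ n X 0 ∧ ContDiffAt ℝ n Y 0 ∧ ContDiffAt ℝ n Φ 0 ∧ X 0 = 0 ∧ Y 0 = 0 ∧
      ∀ᶠ z in 𝓝 (0 : ℝ × ℝ), F z = X z.1 ^ (2 * p) + Y z ^ 2 ∧ Φ (X z.1, Y z) = z ∧
        (Φ (X z.1, 0)).1 = z.1 ∧ SignType.sign (partialY F z) = SignType.sign (Y z) ∧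
        SignType.sign (X z.1) = SignType.sign z.1 := by
  have h1n := one_le_of_infty_or_omega hn
  have hn0 := ne_zero_of_infty_or_omega hn
  obtain ⟨φ, hφs, hφO, hφe, c, hc, hcO⟩ := hord
  have hφ0 : φ 0 = 0 := by simpa using (isBigO_iff.1 hφO).choose_spec.self_of_nhds
  have hF0 : F (0, 0) = 0 := by simpa using (isBigO_iff.1 hFv).choose_spec.self_of_nhds
  have hF2 := partialY_partialY_eq hn hF hFv
  have hφ : ContDiffAt ℝ n φ 0 :=
    contDiffAt_of_partialY_eq_zero hn hF (by rw [hF2]; exact hκ.ne') hφs.continuousAt hφ0 hφe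
  have hφ1 : ContDiffAt ℝ n (fun z : ℝ × ℝ => φ z.1) 0 :=
    ContDiffAt.comp (g := φ) (0 : ℝ × ℝ) hφ contDiffAt_fst
  have hιφ : ContDiffAt ℝ n (fun u : ℝ => F (u, φ u)) 0 := by
    refine ContDiffAt.comp (g := F) (f := fun u : ℝ => (u, φ u)) (0 : ℝ) ?_
      (contDiffAt_id.prodMk hφ)
    simpa [hφ0, Prod.mk_zero_zero] using hF
  obtain ⟨q, hq, hqe⟩ := exists_eq_pow_mul hn (2 * p + 1)
    (f := fun u : ℝ => F (u, φ u) - c * u ^ (2 * p)) (hιφ.sub (by fun_prop)) hcO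
  obtain ⟨G, hG, hGe⟩ := exists_eq_sq_mul hn hF hφ hφ0 hφe
  -- the value of `G` at the origin
  have hι : Tendsto (fun v : ℝ => ((0 : ℝ), v)) (𝓝 0) (𝓝 0) :=
    (Continuous.prodMk continuous_const continuous_id).tendsto 0
  have hFι : ContDiffAt ℝ n (fun v : ℝ => F (0, v)) 0 :=
    ContDiffAt.comp (g := F) (0 : ℝ) hF (contDiffAt_const.prodMk contDiffAt_id)
  have hG0 : G 0 = κ / 2 := by
    obtain ⟨r, hr, hre⟩ := exists_eq_pow_mul hn 3 (f := fun v : ℝ => F (0, v) - κ / 2 * v ^ 2)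
      (hFι.sub (by fun_prop)) hFv
    have h1 : Tendsto (fun v : ℝ => G (0, v)) (𝓝[≠] 0) (𝓝 (G 0)) :=
      (hG.continuousAt.tendsto.comp hι).mono_left nhdsWithin_le_nhds
    have h2 : Tendsto (fun v : ℝ => κ / 2 + v * r v) (𝓝[≠] 0) (𝓝 (κ / 2)) := by
      have : ContinuousAt (fun v : ℝ => κ / 2 + v * r v) 0 :=
        continuousAt_const.add (continuousAt_id.mul hr.continuousAt)
      have h3 := this.tendsto.mono_left (nhdsWithin_le_nhds (s := {0}ᶜ))
      simpa using h3
    refine tendsto_nhds_unique (h1.congr' ?_) h2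
    filter_upwards [nhdsWithin_le_nhds hre, nhdsWithin_le_nhds (hι.eventually hGe),
      self_mem_nhdsWithin] with v h3 h4 h5
    have h5' : v ≠ 0 := h5
    simp only [hφ0, hF0, sub_zero, zero_add] at h3 h4
    have : v ^ 2 * G (0, v) = v ^ 2 * (κ / 2 + v * r v) := by
      rw [← h4]; linarith
    exact mul_left_cancel₀ (pow_ne_zero 2 h5') this
  -- the coordinate `X`
  let g : ℝ → ℝ := fun u => c + u * q u
  have hg : ContDiffAt ℝ n g 0 := contDiffAt_const.add (contDiffAt_id.mul hq)
  have hg0 : g 0 = c := by simp [g]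
  let k : ℝ → ℝ := fun u => g u ^ (1 / (2 * p : ℝ))
  have hk : ContDiffAt ℝ n k 0 := hg.rpow_const_of_ne (by rw [hg0]; exact hc.ne')
  have hgpos : ∀ᶠ u in 𝓝 (0 : ℝ), 0 < g u :=
    hg.continuousAt.eventually (lt_mem_nhds (by rw [hg0]; exact hc))
  let X : ℝ → ℝ := fun u => u * k u
  have hX : ContDiffAt ℝ n X 0 := contDiffAt_id.mul hk
  have hX0 : X 0 = 0 := by simp [X]
  have hXd : HasDerivAt X (k 0) 0 := by
    have := (hasDerivAt_id (0 : ℝ)).mul (hk.differentiableAt hn0).hasDerivAt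
    exact this.congr_deriv (by simp)
  have hkpos : ∀ᶠ u in 𝓝 (0 : ℝ), 0 < k u := hgpos.mono fun u hu => Real.rpow_pos_of_pos hu _
  have hXpow : ∀ᶠ u in 𝓝 (0 : ℝ), X u ^ (2 * p) = F (u, φ u) := by
    filter_upwards [hgpos, hqe] with u h1 h2
    have h3 : k u ^ (2 * p) = g u := by
      have hp0 : (2 * p : ℝ) ≠ 0 := by positivity
      have : k u ^ (2 * p) = (g u ^ (1 / (2 * p : ℝ))) ^ ((2 * p : ℕ) : ℝ) :=
        (Real.rpow_natCast _ _).symm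
      rw [this, ← Real.rpow_mul h1.le]
      push_cast
      rw [one_div, inv_mul_cancel₀ hp0, Real.rpow_one]
    simp only [X, mul_pow, h3, g]
    rw [pow_succ] at h2
    linarith
  -- the coordinate `Y`
  let Y : ℝ × ℝ → ℝ := fun z => (z.2 - φ z.1) * √(G z)
  have hG0pos : 0 < G 0 := by rw [hG0]; positivity
  have hY : ContDiffAt ℝ n Y 0 := (contDiffAt_snd.sub hφ1).mul (hG.sqrt hG0pos.ne')
  have hY0 : Y 0 = 0 := by simp [Y, hφ0]
  have hGpos : ∀ᶠ z in 𝓝 (0 : ℝ × ℝ), 0 < G z := hG.continuousAt.eventually (lt_mem_nhds hG0pos)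
  have hYd : 0 < partialY Y 0 := by
    have h1 := hasDerivAt_partialY (hY.differentiableAt hn0)
    have hs : DifferentiableAt ℝ (fun v : ℝ => √(G (0, v))) 0 :=
      DifferentiableAt.comp (g := fun z => √(G z)) (0 : ℝ)
        ((hG.sqrt hG0pos.ne').differentiableAt hn0)
        (DifferentiableAt.prodMk (differentiableAt_const _) differentiableAt_id)
    have h2 := (hasDerivAt_id (0 : ℝ)).mul hs.hasDerivAt
    have h3 : (fun v : ℝ => Y (((0 : ℝ × ℝ)).1, v)) = id * (fun v : ℝ => √(G (0, v))) := by
      ext v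
      simp [Y, hφ0]
    rw [h3] at h1
    have h4 := h1.unique h2
    rw [h4]
    simpa [Prod.mk_zero_zero] using hG0pos
  obtain ⟨Φ, hΦ, hΦe⟩ := exists_triangular_inverse hn0 hX hY hX0 hY0
    (by rw [hXd.deriv]; exact hkpos.self_of_nhds.ne') hYd.ne'
  have hfst : Tendsto (fun z : ℝ × ℝ => z.1) (𝓝 0) (𝓝 0) := continuous_fst.tendsto 0
  have eF : ∀ᶠ z in 𝓝 (0 : ℝ × ℝ), F z = X z.1 ^ (2 * p) + Y z ^ 2 := by
    filter_upwards [hGe, hGpos, hfst.eventually hXpow] with z h1 h2 h3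
    rw [h3, h1]
    simp only [Y, mul_pow, Real.sq_sqrt h2.le]
  -- The point `(u, φ(u))` has coordinates `(X(u), 0)`; hence `u` is recovered from `X` alone.
  have eU : ∀ᶠ u in 𝓝 (0 : ℝ), (Φ (X u, 0)).1 = u := by
    have ht : Tendsto (fun u : ℝ => (u, φ u)) (𝓝 0) (𝓝 (0 : ℝ × ℝ)) := by
      have := (continuousAt_id.prodMk hφ.continuousAt).tendsto (x := (0 : ℝ))
      simpa [hφ0, Prod.mk_zero_zero] using this
    filter_upwards [ht.eventually hΦe] with u hu
    have : Y (u, φ u) = 0 := by simp [Y]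
    rw [this] at hu
    simp [hu]
  have hFd : ∀ᶠ z in 𝓝 (0 : ℝ × ℝ), DifferentiableAt ℝ F z :=
    ((hF.of_le h1n).eventually (by simp)).mono fun v hv => hv.differentiableAt (by simp)
  have hYdiff : ∀ᶠ z in 𝓝 (0 : ℝ × ℝ), DifferentiableAt ℝ Y z :=
    ((hY.of_le h1n).eventually (by simp)).mono fun v hv => hv.differentiableAt (by simp)
  have hYpos : ∀ᶠ z in 𝓝 (0 : ℝ × ℝ), 0 < partialY Y z :=
    (contDiffAt_partialY hn hY).continuousAt.eventually (lt_mem_nhds hYd)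
  -- Differentiating `F = X^{2p} + Y²` in `v`, where `X` is constant, gives `F_v = 2 Y Y_v` with
  -- `Y_v > 0`.
  have eS : ∀ᶠ z in 𝓝 (0 : ℝ × ℝ), SignType.sign (partialY F z) = SignType.sign (Y z) := by
    filter_upwards [hFd, hYdiff, hYpos, eF.eventually_nhds] with z h1 h2 h3 h4
    have h5 : (fun v : ℝ => F (z.1, v)) =ᶠ[𝓝 z.2]
        fun v => X z.1 ^ (2 * p) + Y (z.1, v) ^ 2 := by
      have : Tendsto (fun v : ℝ => (z.1, v)) (𝓝 z.2) (𝓝 z) :=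
        (Continuous.prodMk continuous_const continuous_id).tendsto z.2
      exact this.eventually h4
    have h6 := ((hasDerivAt_partialY h2).pow 2).const_add (X z.1 ^ (2 * p))
    have h7 := (hasDerivAt_partialY h1).unique (h6.congr_of_eventuallyEq h5)
    rw [h7]
    have : ((2 : ℕ) : ℝ) * Y (z.1, z.2) ^ (2 - 1) * partialY Y z = Y z * (2 * partialY Y z) := by
      norm_num
      ring
    rw [this, sign_mul_pos (by positivity)]
  refine ⟨X, Y, Φ, hX, hY, hΦ, hX0, hY0, ?_⟩
  filter_upwards [eF, hΦe, hfst.eventually eU, eS, hfst.eventually hkpos] with z h1 h2 h3 h4 h5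
  exact ⟨h1, h2, h3, h4, sign_mul_pos h5⟩

/-! ### Shape of the periodic orbits and integration along their two arcs. -/

namespace IsPeriodicOrbit

variable {F : ℝ × ℝ → ℝ} {h : ℝ} {γ : ℝ → ℝ × ℝ} {T : ℝ}

theorem continuous (hγ : IsPeriodicOrbit F h γ T) : Continuous γ :=
  continuous_iff_continuousAt.2 fun t => (hγ.flow t).continuousAt

theorem periodic (hγ : IsPeriodicOrbit F h γ T) : Function.Periodic γ T := hγ.closed

theorem hasDerivAt_fst (hγ : IsPeriodicOrbit F h γ T) (t : ℝ) :
    HasDerivAt (fun t => (γ t).1) (partialY F (γ t)) t := by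
  have h1 := HasFDerivAt.comp_hasDerivAt t (hasFDerivAt_fst (𝕜 := ℝ) (p := γ t)) (hγ.flow t)
  exact h1

/-- By periodicity, injectivity on `[0, T)` passes to every half-open interval of length `T`. -/
theorem eq_of_mem_Ico (hγ : IsPeriodicOrbit F h γ T) {t₀ s t : ℝ} (hs : s ∈ Ico t₀ (t₀ + T))
    (ht : t ∈ Ico t₀ (t₀ + T)) (hst : γ s = γ t) : s = t := by
  have hmod : ∀ x, γ (toIcoMod hγ.period_pos 0 x) = γ x := fun x => by
    rw [toIcoMod]
    exact hγ.periodic.sub_zsmul_eq _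
  have h1 : ∀ x, toIcoMod hγ.period_pos 0 x ∈ Ico 0 T := fun x => by
    simpa using toIcoMod_mem_Ico hγ.period_pos 0 x
  have h2 : toIcoMod hγ.period_pos 0 s = toIcoMod hγ.period_pos 0 t :=
    hγ.simple (h1 s) (h1 t) (by rw [hmod, hmod, hst])
  have h3 := (toIcoMod_inj hγ.period_pos (c := t₀)).2 ((toIcoMod_inj hγ.period_pos).1 h2)
  rwa [(toIcoMod_eq_self hγ.period_pos).2 hs, (toIcoMod_eq_self hγ.period_pos).2 ht] at h3

theorem not_const (hγ : IsPeriodicOrbit F h γ T) {z : ℝ × ℝ} (hz : ∀ t, γ t = z) : False := by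
  have hT := hγ.period_pos
  have := hγ.simple (x₁ := 0) (x₂ := T / 2) ⟨le_rfl, hT⟩ ⟨by positivity, by linarith⟩
    (by rw [hz, hz])
  linarith

end IsPeriodicOrbit

/-- The relations between a Hamiltonian `F` and coordinates `(X, Y)` with `F = X^{2p} + Y²`, at a
point. -/
structure NormalCoordinatesAt (F : ℝ × ℝ → ℝ) (p : ℕ) (X : ℝ → ℝ) (Y : ℝ × ℝ → ℝ)
    (Φ : ℝ × ℝ → ℝ × ℝ) (z : ℝ × ℝ) : Prop where
  eq : F z = X z.1 ^ (2 * p) + Y z ^ 2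
  inverse : Φ (X z.1, Y z) = z
  inverse_fst : (Φ (X z.1, 0)).1 = z.1
  sign_Y : SignType.sign (partialY F z) = SignType.sign (Y z)
  sign_X : SignType.sign (X z.1) = SignType.sign z.1

section Arcs

variable {F : ℝ × ℝ → ℝ} {γ : ℝ → ℝ × ℝ} {T : ℝ} {p : ℕ} {X : ℝ → ℝ} {Y : ℝ × ℝ → ℝ}
  {Φ : ℝ × ℝ → ℝ × ℝ} {ρ : ℝ}

theorem eq_or_eq_neg_of_pow_eq (hp : 1 ≤ p) {x : ℝ} (hρ : 0 < ρ) (h : x ^ (2 * p) = ρ ^ (2 * p)) :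
    x = ρ ∨ x = -ρ := by
  have h1 : |x| ^ (2 * p) = ρ ^ (2 * p) := by
    rw [← h, Even.pow_abs (even_two_mul p)]
  have h2 := (pow_left_inj₀ (abs_nonneg x) hρ.le (by omega)).1 h1
  exact (abs_eq hρ.le).1 h2

/-- If the coordinate function `Y` has no zeros along an arc of the orbit, it has the sign of the
increment of the first coordinate. -/
theorem neg_of_fst_lt (hγ : IsPeriodicOrbit F (ρ ^ (2 * p)) γ T)
    (hN : ∀ t, NormalCoordinatesAt F p X Y Φ (γ t)) (hY : ∀ t, ContinuousAt Y (γ t))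
    {a b : ℝ} (hab : a < b) (hlt : (γ b).1 < (γ a).1) (h0 : ∀ t ∈ Ioo a b, Y (γ t) ≠ 0) :
    ∀ t ∈ Ioo a b, Y (γ t) < 0 := by
  intro s hs
  refine lt_of_le_of_ne (not_lt.1 fun hpos => ?_) (h0 s hs)
  have hYc : Continuous fun t => Y (γ t) := continuous_iff_continuousAt.2 fun t =>
    (hY t).comp hγ.continuous.continuousAt
  have hall : ∀ t ∈ Ioo a b, 0 < Y (γ t) := fun t ht => by
    by_contra! hle
    obtain ⟨r, hr, hr0⟩ := isPreconnected_Ioo.intermediate_value ht hs hYc.continuousOn ⟨hle, hpos.le⟩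
    exact h0 r hr hr0
  have hmono : StrictMonoOn (fun t => (γ t).1) (Icc a b) := by
    refine strictMonoOn_of_deriv_pos (convex_Icc a b)
      (continuous_fst.comp hγ.continuous).continuousOn fun t ht => ?_
    rw [interior_Icc] at ht
    rw [(hγ.hasDerivAt_fst t).deriv]
    have h1 := (hN t).sign_Y
    rw [sign_pos (hall t ht)] at h1
    exact sign_eq_one_iff.1 h1
  exact absurd (hmono (left_mem_Icc.2 hab.le) (right_mem_Icc.2 hab.le) hab) (not_lt.2 hlt.le)

theorem pos_of_fst_lt (hγ : IsPeriodicOrbit F (ρ ^ (2 * p)) γ T)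
    (hN : ∀ t, NormalCoordinatesAt F p X Y Φ (γ t)) (hY : ∀ t, ContinuousAt Y (γ t))
    {a b : ℝ} (hab : a < b) (hlt : (γ a).1 < (γ b).1) (h0 : ∀ t ∈ Ioo a b, Y (γ t) ≠ 0) :
    ∀ t ∈ Ioo a b, 0 < Y (γ t) := by
  intro s hs
  refine lt_of_le_of_ne (not_lt.1 fun hneg => ?_) (h0 s hs).symm
  have hYc : Continuous fun t => Y (γ t) := continuous_iff_continuousAt.2 fun t =>
    (hY t).comp hγ.continuous.continuousAt
  have hall : ∀ t ∈ Ioo a b, Y (γ t) < 0 := fun t ht => by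
    by_contra! hle
    obtain ⟨r, hr, hr0⟩ := isPreconnected_Ioo.intermediate_value hs ht hYc.continuousOn
      ⟨hneg.le, hle⟩
    exact h0 r hr hr0
  have hanti : StrictAntiOn (fun t => (γ t).1) (Icc a b) := by
    refine strictAntiOn_of_deriv_neg (convex_Icc a b)
      (continuous_fst.comp hγ.continuous).continuousOn fun t ht => ?_
    rw [interior_Icc] at ht
    rw [(hγ.hasDerivAt_fst t).deriv]
    have h1 := (hN t).sign_Y
    rw [sign_neg (hall t ht)] at h1
    exact sign_eq_neg_one_iff.1 h1
  exact absurd (hanti (left_mem_Icc.2 hab.le) (right_mem_Icc.2 hab.le) hab) (not_lt.2 hlt.le)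

/-- A periodic orbit near the center consists of a lower arc from `(ρ, 0)` to `(-ρ, 0)` and an
upper arc from `(-ρ, 0)` to `(ρ, 0)`, in the coordinates `(X, Y)`. -/
theorem exists_arcs (hp : 1 ≤ p) (hρ : 0 < ρ) (hγ : IsPeriodicOrbit F (ρ ^ (2 * p)) γ T)
    (hN : ∀ t, NormalCoordinatesAt F p X Y Φ (γ t)) (hY : ∀ t, ContinuousAt Y (γ t)) :
    ∃ t₀ t₁, t₀ < t₁ ∧ t₁ < t₀ + T ∧ X (γ t₀).1 = ρ ∧ X (γ t₁).1 = -ρ ∧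
      (∀ t ∈ Ioo t₀ t₁, Y (γ t) < 0) ∧ ∀ t ∈ Ioo t₁ (t₀ + T), 0 < Y (γ t) := by
  have hT := hγ.period_pos
  have hu : Continuous fun t => (γ t).1 := continuous_fst.comp hγ.continuous
  -- The arcs are cut at the maximum and the minimum of `u` along the orbit. There `u' = F_v = 0`,
  -- hence `Y = 0` and `X = ±ρ`. The time of the minimum is shifted into the period that starts at
  -- `t₀`.
  obtain ⟨t₀, _, ht₀⟩ := isCompact_Icc.exists_isMaxOn (nonempty_Icc.2 hT.le) hu.continuousOn
  have hmax : ∀ t, (γ t).1 ≤ (γ t₀).1 := fun t => by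
    obtain ⟨s, hs, hst⟩ := hγ.periodic.exists_mem_Ico₀ hT t
    rw [hst]
    exact ht₀ (Ico_subset_Icc_self hs)
  obtain ⟨t₂, _, ht₂⟩ := isCompact_Icc.exists_isMinOn (nonempty_Icc.2 hT.le) hu.continuousOn
  obtain ⟨t₁, ht₁, ht₁₂⟩ := hγ.periodic.exists_mem_Ico hT t₂ t₀
  have hmin : ∀ t, (γ t₁).1 ≤ (γ t).1 := fun t => by
    obtain ⟨s, hs, hst⟩ := hγ.periodic.exists_mem_Ico₀ hT t
    rw [hst, ← ht₁₂]
    exact ht₂ (Ico_subset_Icc_self hs)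
  have hYzero : ∀ t, partialY F (γ t) = 0 → Y (γ t) = 0 := fun t ht => by
    have := (hN t).sign_Y
    rw [ht, sign_zero] at this
    exact sign_eq_zero_iff.1 this.symm
  have hne : (γ t₁).1 ≠ (γ t₀).1 := fun he => by
    have hconst : ∀ t, (γ t).1 = (γ t₀).1 := fun t =>
      le_antisymm (hmax t) (he ▸ hmin t)
    refine hγ.not_const (z := Φ (X (γ t₀).1, 0)) fun t => ?_
    have h1 := hγ.hasDerivAt_fst t
    simp only [hconst] at h1
    have h2 := hYzero t (h1.unique (hasDerivAt_const t _))
    have h3 := (hN t).inverse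
    rw [h2, hconst t] at h3
    exact h3.symm
  have hlt : (γ t₁).1 < (γ t₀).1 := lt_of_le_of_ne (hmax t₁) hne
  have hzero : ∀ t, Y (γ t) = 0 → X (γ t).1 = ρ ∨ X (γ t).1 = -ρ := fun t ht => by
    have h1 := (hN t).eq
    rw [hγ.level t, ht] at h1
    exact eq_or_eq_neg_of_pow_eq hp hρ (by simpa using h1.symm)
  have hY0 : Y (γ t₀) = 0 := hYzero t₀
    ((show IsLocalMax (fun t => (γ t).1) t₀ from Eventually.of_forall hmax)
      |>.hasDerivAt_eq_zero (hγ.hasDerivAt_fst t₀))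
  have hY1 : Y (γ t₁) = 0 := hYzero t₁
    ((show IsLocalMin (fun t => (γ t).1) t₁ from Eventually.of_forall hmin)
      |>.hasDerivAt_eq_zero (hγ.hasDerivAt_fst t₁))
  have hXne : X (γ t₁).1 ≠ X (γ t₀).1 := fun he => hne (by
    rw [← (hN t₁).inverse_fst, ← (hN t₀).inverse_fst, he])
  have hX : X (γ t₀).1 = ρ ∧ X (γ t₁).1 = -ρ := by
    rcases hzero t₀ hY0 with h0 | h0 <;> rcases hzero t₁ hY1 with h1 | h1
    · exact absurd (h1.trans h0.symm) hXne
    · exact ⟨h0, h1⟩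
    -- The opposite assignment would give `u(t₀) < 0 < u(t₁)`, against the choice of `t₀` as a
    -- maximum.
    · have h2 := (hN t₀).sign_X
      have h3 := (hN t₁).sign_X
      rw [h0, sign_neg (neg_neg_of_pos hρ)] at h2
      rw [h1, sign_pos hρ] at h3
      have := sign_eq_neg_one_iff.1 h2.symm
      have := sign_eq_one_iff.1 h3.symm
      linarith
    · exact absurd (h1.trans h0.symm) hXne
  have ht01 : t₀ < t₁ := lt_of_le_of_ne ht₁.1 fun he => hne (by rw [he])
  -- A zero of `Y` has coordinates `(±ρ, 0)`, so it is the point `γ t₀` or `γ t₁`, and a simple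
  -- orbit meets each of them once per period.
  have hYne : ∀ t ∈ Ioo t₀ (t₀ + T), t ≠ t₁ → Y (γ t) ≠ 0 := by
    intro t ht htne ht0
    have h1 := (hN t).inverse
    rcases hzero t ht0 with h2 | h2
    · have h3 := (hN t₀).inverse
      rw [hX.1, hY0] at h3
      rw [h2, ht0, h3] at h1
      exact ht.1.ne (hγ.eq_of_mem_Ico ⟨le_rfl, by linarith⟩ ⟨ht.1.le, ht.2⟩ h1)
    · have h3 := (hN t₁).inverse
      rw [hX.2, hY1] at h3
      rw [h2, ht0, h3] at h1
      exact htne (hγ.eq_of_mem_Ico ht₁ ⟨ht.1.le, ht.2⟩ h1).symm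
  refine ⟨t₀, t₁, ht01, ht₁.2, hX.1, hX.2, ?_, ?_⟩
  · exact neg_of_fst_lt hγ hN hY ht01 hlt fun t ht =>
      hYne t ⟨ht.1, ht.2.trans ht₁.2⟩ ht.2.ne
  · refine pos_of_fst_lt hγ hN hY ht₁.2 (by rw [hγ.closed]; exact hlt) fun t ht =>
      hYne t ⟨ht01.trans ht.1, ht.2⟩ ht.1.ne'

theorem abs_coordinate_le (hp : 1 ≤ p) (hρ : 0 < ρ) (hγ : IsPeriodicOrbit F (ρ ^ (2 * p)) γ T)
    (hN : ∀ t, NormalCoordinatesAt F p X Y Φ (γ t)) (t : ℝ) : |X (γ t).1| ≤ ρ := by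
  have h1 := (hN t).eq
  rw [hγ.level t] at h1
  have h2 : |X (γ t).1| ^ (2 * p) ≤ ρ ^ (2 * p) := by
    rw [Even.pow_abs (even_two_mul p), h1]
    nlinarith [sq_nonneg (Y (γ t))]
  exact (pow_le_pow_iff_left₀ (abs_nonneg _) hρ.le (by omega)).1 h2

theorem continuousOn_level_curve (hρ : 0 < ρ) {f : ℝ × ℝ → ℝ}
    (hf : ∀ x y, |x| ≤ ρ → |y| ≤ ρ ^ p → ContinuousAt f (x, y)) {ε : ℝ} (hε : |ε| = 1) :
    ContinuousOn (fun s => f (ρ * s, ε * (ρ ^ p * √(1 - s ^ (2 * p))))) (Icc (-1) 1) := by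
  intro s hs
  have hs1 : |s| ≤ 1 := abs_le.2 hs
  refine ContinuousAt.continuousWithinAt ?_
  refine ContinuousAt.comp (f := fun s : ℝ => (ρ * s, ε * (ρ ^ p * √(1 - s ^ (2 * p)))))
    (hf _ _ ?_ ?_) (by fun_prop)
  · rw [abs_mul, abs_of_pos hρ]
    exact mul_le_of_le_one_right hρ.le hs1
  · rw [abs_mul, hε, one_mul, abs_of_nonneg (by positivity)]
    refine mul_le_of_le_one_right (by positivity) (Real.sqrt_le_one.2 ?_)
    have : 0 ≤ s ^ (2 * p) := (even_two_mul p).pow_nonneg s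
    linarith

/-- A line integral along one arc, in the coordinates `(X, Y)`. -/
theorem integral_arc (hp : 1 ≤ p) (hρ : 0 < ρ) (hγ : IsPeriodicOrbit F (ρ ^ (2 * p)) γ T)
    (hN : ∀ t, NormalCoordinatesAt F p X Y Φ (γ t)) {ε : ℝ} (hε : ε ^ 2 = 1) {f : ℝ × ℝ → ℝ}
    (hf : ∀ x y, |x| ≤ ρ → |y| ≤ ρ ^ p → ContinuousAt f (x, y)) {x' : ℝ → ℝ}
    (hx' : ∀ t, HasDerivAt (fun t => X (γ t).1) (x' t) t) (hx'c : Continuous x') {a b : ℝ}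
    (hab : a ≤ b) (hYε : ∀ t ∈ Icc a b, 0 ≤ ε * Y (γ t)) :
    ∫ t in a..b, f (X (γ t).1, Y (γ t)) * x' t =
      ρ * ∫ s in (X (γ a).1 / ρ)..(X (γ b).1 / ρ),
        f (ρ * s, ε * (ρ ^ p * √(1 - s ^ (2 * p)))) := by
  have hle := abs_coordinate_le hp hρ hγ hN
  let g : ℝ → ℝ := fun s => f (ρ * s, ε * (ρ ^ p * √(1 - s ^ (2 * p))))
  have hεabs : |ε| = 1 := by
    have : |ε| ^ 2 = 1 := by rw [sq_abs, hε]
    exact (pow_eq_one_iff_of_nonneg (abs_nonneg _) two_ne_zero).1 this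
  have hg : ContinuousOn g (Icc (-1) 1) := continuousOn_level_curve hρ hf hεabs
  have hsub := intervalIntegral.integral_comp_mul_deriv'' (a := a) (b := b)
    (f := fun t => X (γ t).1 / ρ) (f' := fun t => x' t / ρ) (g := g)
    (fun t _ => ((hx' t).div_const ρ).continuousAt.continuousWithinAt)
    (fun t _ => ((hx' t).div_const ρ).hasDerivWithinAt)
    (hx'c.div_const ρ).continuousOn
    (hg.mono (by
      rintro _ ⟨t, _, rfl⟩
      have := hle t
      refine abs_le.1 ?_
      rw [abs_div, abs_of_pos hρ]
      exact (div_le_one hρ).2 this))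
  rw [← hsub, ← intervalIntegral.integral_const_mul]
  refine intervalIntegral.integral_congr fun t ht => ?_
  rw [uIcc_of_le hab] at ht
  have h1 : ρ * (X (γ t).1 / ρ) = X (γ t).1 := by field_simp
  -- The level equation `X^{2p} + Y² = ρ^{2p}` determines `|Y|` from `s = X/ρ`; the sign `ε` of the
  -- arc determines `Y`.
  have h2 : ε * (ρ ^ p * √(1 - (X (γ t).1 / ρ) ^ (2 * p))) = Y (γ t) := by
    have h3 : ρ ^ p * √(1 - (X (γ t).1 / ρ) ^ (2 * p)) = |Y (γ t)| := by
      rw [← Real.sqrt_sq_eq_abs, ← Real.sqrt_sq (show 0 ≤ ρ ^ p by positivity),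
        ← Real.sqrt_mul (by positivity)]
      congr 1
      have h4 := (hN t).eq
      rw [hγ.level t] at h4
      rw [div_pow, ← pow_mul, mul_comm p 2]
      field_simp
      linarith
    rw [h3]
    have h5 : |ε * Y (γ t)| = |Y (γ t)| := by rw [abs_mul, hεabs, one_mul]
    rw [← h5, abs_of_nonneg (hYε t ht), ← mul_assoc, ← pow_two, hε, one_mul]
  simp only [Function.comp, g]
  rw [h1, h2]
  field_simp

/-- A line integral along a periodic orbit near the center, in the coordinates `(X, Y)`. -/
theorem integral_orbit (hp : 1 ≤ p) (hρ : 0 < ρ) (hγ : IsPeriodicOrbit F (ρ ^ (2 * p)) γ T)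
    (hN : ∀ t, NormalCoordinatesAt F p X Y Φ (γ t)) (hY : ∀ t, ContinuousAt Y (γ t))
    {f : ℝ × ℝ → ℝ} (hf : ∀ x y, |x| ≤ ρ → |y| ≤ ρ ^ p → ContinuousAt f (x, y)) {x' : ℝ → ℝ}
    (hx' : ∀ t, HasDerivAt (fun t => X (γ t).1) (x' t) t) (hx'c : Continuous x')
    (hx'p : Function.Periodic x' T) :
    ∫ t in (0 : ℝ)..T, f (X (γ t).1, Y (γ t)) * x' t =
      ρ * ∫ s in (-1 : ℝ)..1, (f (ρ * s, ρ ^ p * √(1 - s ^ (2 * p)))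
        - f (ρ * s, -(ρ ^ p * √(1 - s ^ (2 * p))))) := by
  obtain ⟨t₀, t₁, h01, h1T, hX0, hX1, hneg, hpos⟩ := exists_arcs hp hρ hγ hN hY
  have hYc : Continuous fun t => Y (γ t) := continuous_iff_continuousAt.2 fun t =>
    (hY t).comp hγ.continuous.continuousAt
  have hXc : Continuous fun t => X (γ t).1 := continuous_iff_continuousAt.2 fun t =>
    (hx' t).continuousAt
  have hlevel : ∀ t, X (γ t).1 ^ (2 * p) + Y (γ t) ^ 2 = ρ ^ (2 * p) := fun t => by
    rw [← (hN t).eq, hγ.level t]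
  have hXle := abs_coordinate_le hp hρ hγ hN
  have hYle : ∀ t, |Y (γ t)| ≤ ρ ^ p := fun t => by
    refine abs_le_of_sq_le_sq ?_ (by positivity)
    rw [← pow_mul, mul_comm p 2, ← hlevel t]
    have : 0 ≤ X (γ t).1 ^ (2 * p) := (even_two_mul p).pow_nonneg _
    linarith
  have hIc : Continuous fun t => f (X (γ t).1, Y (γ t)) * x' t := by
    refine Continuous.mul (continuous_iff_continuousAt.2 fun t => ?_) hx'c
    exact ContinuousAt.comp (f := fun t => (X (γ t).1, Y (γ t))) (hf _ _ (hXle t) (hYle t))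
      (hXc.prodMk hYc).continuousAt
  have hIp : Function.Periodic (fun t => f (X (γ t).1, Y (γ t)) * x' t) T := fun t => by
    simp only [hγ.closed t, hx'p t]
  have hnegc : ∀ t ∈ Icc t₀ t₁, 0 ≤ -1 * Y (γ t) := by
    rw [← closure_Ioo h01.ne]
    refine fun t ht => closure_minimal (s := Ioo t₀ t₁) (t := {t | 0 ≤ -1 * Y (γ t)})
      (fun s hs => ?_) (isClosed_le continuous_const (continuous_const.mul hYc)) ht
    have := hneg s hs
    exact show (0 : ℝ) ≤ _ by linarith
  have hposc : ∀ t ∈ Icc t₁ (t₀ + T), 0 ≤ 1 * Y (γ t) := by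
    rw [← closure_Ioo h1T.ne]
    refine fun t ht => closure_minimal (s := Ioo t₁ (t₀ + T)) (t := {t | 0 ≤ 1 * Y (γ t)})
      (fun s hs => ?_) (isClosed_le continuous_const (continuous_const.mul hYc)) ht
    have := hpos s hs
    exact show (0 : ℝ) ≤ _ by linarith
  -- The period is moved to `[t₀, t₀ + T]`. The lower arc runs from `s = 1` to `s = -1`, which
  -- accounts for the minus sign in the result.
  have hshift := hIp.intervalIntegral_add_eq 0 t₀
  rw [zero_add] at hshift
  rw [hshift, ← intervalIntegral.integral_add_adjacent_intervals
    (hIc.intervalIntegrable t₀ t₁) (hIc.intervalIntegrable t₁ (t₀ + T)),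
    integral_arc hp hρ hγ hN (by norm_num) hf hx' hx'c h01.le hnegc,
    integral_arc hp hρ hγ hN (by norm_num) hf hx' hx'c h1T.le hposc,
    hγ.closed, hX0, hX1, neg_div, div_self hρ.ne', intervalIntegral.integral_symm]
  have hci : ∀ ε : ℝ, |ε| = 1 → IntervalIntegrable
      (fun s => f (ρ * s, ε * (ρ ^ p * √(1 - s ^ (2 * p))))) MeasureTheory.volume (-1) 1 :=
    fun ε hε => (continuousOn_level_curve hρ hf hε).intervalIntegrable_of_Icc (by norm_num)
  have e1 := hci 1 (by simp)
  have e2 := hci (-1) (by simp)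
  simp only [one_mul, neg_one_mul] at e1 e2 ⊢
  rw [intervalIntegral.integral_sub e1 e2]
  ring

end Arcs

/-! ### Reduction of the Melnikov form to a multiple of `du`. -/

section LineIntegral

variable {E : Type}

/-- The primitive `∫_0^v P(u, s, δ) ds` of `P` in the second variable. -/
def primitiveY (P : ℝ × ℝ → E → ℝ) (z : ℝ × ℝ) (δ : E) : ℝ :=
  ∫ t in (0 : ℝ)..1, z.2 * P (z.1, t * z.2) δ

/-- The coefficient `K` of a one-form `K du` cohomologous to `Q du - P dv`. -/
def reducedForm (P Q : ℝ × ℝ → E → ℝ) (z : ℝ × ℝ) (δ : E) : ℝ :=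
  Q z δ + partialX (fun z => primitiveY P z δ) z

theorem hasDerivAt_primitiveY {P : ℝ × ℝ → E → ℝ} {δ : E} {η : ℝ}
    (hP : ∀ z ∈ Metric.ball (0 : ℝ × ℝ) η, ContinuousAt (fun z => P z δ) z) {z : ℝ × ℝ}
    (hz : z ∈ Metric.ball (0 : ℝ × ℝ) η) :
    HasDerivAt (fun v => primitiveY P (z.1, v) δ) (P z δ) z.2 := by
  -- The substitution `s = t v` turns the integral over `[0, 1]`, whose fixed interval suits
  -- differentiation in all variables, into the usual primitive.
  have heq : (fun v => primitiveY P (z.1, v) δ) = fun v => ∫ s in (0 : ℝ)..v, P (z.1, s) δ := by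
    ext v
    have := intervalIntegral.mul_integral_comp_mul_right (a := 0) (b := 1)
      (f := fun s => P (z.1, s) δ) v
    rw [zero_mul, one_mul] at this
    rw [← this, primitiveY, intervalIntegral.integral_const_mul]
  rw [heq]
  have hz' : |z.1| < η ∧ |z.2| < η := by
    simpa [Prod.norm_def] using hz
  have hc : ∀ s, |s| < η → ContinuousAt (fun s => P (z.1, s) δ) s := fun s hs =>
    ContinuousAt.comp (f := fun s => (z.1, s)) (hP (z.1, s) (by simp [Prod.norm_def, hz'.1, hs]))
      (by fun_prop)
  have hopen : IsOpen {s : ℝ | |s| < η} := isOpen_lt (by fun_prop) continuous_const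
  have hon : ContinuousOn (fun s => P (z.1, s) δ) {s : ℝ | |s| < η} := fun s hs =>
    (hc s hs).continuousWithinAt
  refine intervalIntegral.integral_hasDerivAt_right ?_
    (hon.stronglyMeasurableAtFilter hopen z.2 hz'.2) (hc z.2 hz'.2)
  refine (hon.mono fun s hs => ?_).intervalIntegrable
  have h1 : |s| ≤ |z.2| := by
    have := abs_sub_left_of_mem_uIcc hs
    simpa using this
  exact h1.trans_lt hz'.2

/-- With `R = ∫_0^v P` one has `dR = R_u du + P dv`, so `Q du - P dv = (Q + R_u) du - dR`, and `dR`
integrates to zero over a closed orbit. -/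
theorem integral_eq_integral_reducedForm {F : ℝ × ℝ → ℝ} {P Q : ℝ × ℝ → E → ℝ} {δ : E} {h : ℝ}
    {γ : ℝ → ℝ × ℝ} {T : ℝ} (hγ : IsPeriodicOrbit F h γ T) {η : ℝ}
    (hη : ∀ t, γ t ∈ Metric.ball (0 : ℝ × ℝ) η) (hF : ∀ t, ContDiffAt ℝ 1 F (γ t))
    (hP : ∀ z ∈ Metric.ball (0 : ℝ × ℝ) η, ContinuousAt (fun z => P z δ) z)
    (hQ : ∀ z ∈ Metric.ball (0 : ℝ × ℝ) η, ContinuousAt (fun z => Q z δ) z)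
    (hR : ∀ t, ContDiffAt ℝ 1 (fun z => primitiveY P z δ) (γ t)) :
    ∫ t in (0 : ℝ)..T, (partialY F (γ t) * Q (γ t) δ + partialX F (γ t) * P (γ t) δ) =
      ∫ t in (0 : ℝ)..T, reducedForm P Q (γ t) δ * partialY F (γ t) := by
  have hγc := hγ.continuous
  have hc : ∀ {g : ℝ × ℝ → ℝ}, (∀ t, ContinuousAt g (γ t)) → Continuous fun t => g (γ t) :=
    fun hg => continuous_iff_continuousAt.2 fun t => (hg t).comp hγc.continuousAt
  have hFX : Continuous fun t => partialX F (γ t) := hc fun t =>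
    ((hF t).continuousAt_fderiv (by simp)).clm_apply continuousAt_const
  have hFY : Continuous fun t => partialY F (γ t) := hc fun t =>
    ((hF t).continuousAt_fderiv (by simp)).clm_apply continuousAt_const
  have hRX : Continuous fun t => partialX (fun z => primitiveY P z δ) (γ t) := hc fun t =>
    ((hR t).continuousAt_fderiv (by simp)).clm_apply continuousAt_const
  have hPc : Continuous fun t => P (γ t) δ := hc (g := fun z => P z δ) fun t => hP _ (hη t)
  have hQc : Continuous fun t => Q (γ t) δ := hc (g := fun z => Q z δ) fun t => hQ _ (hη t)
  have hRd : ∀ t, HasDerivAt (fun t => primitiveY P (γ t) δ)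
      (partialX (fun z => primitiveY P z δ) (γ t) * partialY F (γ t)
        - partialX F (γ t) * P (γ t) δ) t := fun t => by
    have h1 := (hR t).differentiableAt (by simp)
    have h2 : partialY (fun z => primitiveY P z δ) (γ t) = P (γ t) δ :=
      (hasDerivAt_partialY h1).unique (hasDerivAt_primitiveY hP (hη t))
    have h3 := h1.hasFDerivAt.comp_hasDerivAt t (hγ.flow t)
    refine h3.congr_deriv ?_
    have h4 : ((partialY F (γ t), -partialX F (γ t)) : ℝ × ℝ) =
        partialY F (γ t) • (1, 0) + (-partialX F (γ t)) • (0, 1) := by simp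
    rw [h4, map_add, map_smul, map_smul]
    have h5 : fderiv ℝ (fun z => primitiveY P z δ) (γ t) (0, 1) = P (γ t) δ := h2
    rw [h5]
    simp only [smul_eq_mul, partialX]
    ring
  have hint := intervalIntegral.integral_eq_sub_of_hasDerivAt (a := 0) (b := T)
    (fun t _ => hRd t) (((hRX.mul hFY).sub (hFX.mul hPc)).intervalIntegrable 0 T)
  have hT : γ T = γ 0 := by simpa using hγ.closed 0
  rw [hT, sub_self] at hint
  have hK : Continuous fun t => reducedForm P Q (γ t) δ * partialY F (γ t) :=
    (hQc.add hRX).mul hFY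
  have hM : Continuous fun t => partialY F (γ t) * Q (γ t) δ + partialX F (γ t) * P (γ t) δ :=
    (hFY.mul hQc).add (hFX.mul hPc)
  have hd : (∫ t in (0 : ℝ)..T, (partialY F (γ t) * Q (γ t) δ + partialX F (γ t) * P (γ t) δ)) -
      (∫ t in (0 : ℝ)..T, reducedForm P Q (γ t) δ * partialY F (γ t)) =
      -∫ t in (0 : ℝ)..T, (partialX (fun z => primitiveY P z δ) (γ t) * partialY F (γ t)
        - partialX F (γ t) * P (γ t) δ) := by
    rw [← intervalIntegral.integral_sub (hM.intervalIntegrable 0 T) (hK.intervalIntegrable 0 T),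
      ← intervalIntegral.integral_neg]
    refine intervalIntegral.integral_congr fun t _ => ?_
    simp only [reducedForm]
    ring
  rw [hint, neg_zero] at hd
  exact sub_eq_zero.1 hd

end LineIntegral

/-! ### The Melnikov function as `ρ^{p+1}` times an even function of `ρ`. -/

section Reduction

variable {E : Type} [NormedAddCommGroup E] [NormedSpace ℝ E] {n : WithTop ℕ∞}

theorem contDiffAt_primitiveY (hn : n = ∞ ∨ n = ω) {P : ℝ × ℝ → E → ℝ} {δ : E}
    (hP : ContDiffAt ℝ n (fun w : (ℝ × ℝ) × E => P w.1 w.2) (0, δ)) :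
    ContDiffAt ℝ n (fun w : (ℝ × ℝ) × E => primitiveY P w.1 w.2) (0, δ) := by
  refine contDiffAt_integral_arc (σ := id) hn zero_le_one continuous_id
    (x₀ := ((0, δ) : (ℝ × ℝ) × E))
    (f := fun w : ((ℝ × ℝ) × E) × ℝ => w.1.1.2 * P (w.1.1.1, w.2 * w.1.1.2) w.1.2) fun s _ => ?_
  refine ContDiffAt.mul (by fun_prop) ?_
  refine ContDiffAt.comp (g := fun w : (ℝ × ℝ) × E => P w.1 w.2)
    (f := fun w : ((ℝ × ℝ) × E) × ℝ => ((w.1.1.1, w.2 * w.1.1.2), w.1.2)) _ ?_ (by fun_prop)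
  simpa [Prod.mk_zero_zero] using hP

theorem contDiffAt_reducedForm (hn : n = ∞ ∨ n = ω) {P Q : ℝ × ℝ → E → ℝ} {δ : E}
    (hP : ContDiffAt ℝ n (fun w : (ℝ × ℝ) × E => P w.1 w.2) (0, δ))
    (hQ : ContDiffAt ℝ n (fun w : (ℝ × ℝ) × E => Q w.1 w.2) (0, δ)) :
    ContDiffAt ℝ n (fun w : (ℝ × ℝ) × E => reducedForm P Q w.1 w.2) (0, δ) := by
  refine hQ.add ?_
  have h1 := ContDiffAt.fderiv (n := n) (m := n) (x₀ := ((0, δ) : (ℝ × ℝ) × E))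
    (f := fun (w : (ℝ × ℝ) × E) z => primitiveY P z w.2) (g := fun w => w.1)
    (ContDiffAt.comp (g := fun w : (ℝ × ℝ) × E => primitiveY P w.1 w.2)
      (f := fun w : ((ℝ × ℝ) × E) × (ℝ × ℝ) => (w.2, w.1.2)) _
      (contDiffAt_primitiveY hn hP) (by fun_prop))
    contDiffAt_fst (add_one_le_of_infty_or_omega hn)
  exact h1.clm_apply contDiffAt_const

/-- The coefficient of the form `K du` in the coordinates `(X, Y)` given by `Φ`. -/
def pulledBackForm {E : Type} (Φ : ℝ × ℝ → ℝ × ℝ) (K : ℝ × ℝ → E → ℝ) (w : (ℝ × E) × ℝ) : ℝ :=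
  K ((Φ (w.1.1, 0)).1, (Φ (w.1.1, w.2)).2) w.1.2 * deriv (fun x => (Φ (x, 0)).1) w.1.1

/-- Since `u = U(X)` with `U(x) = (Φ (x, 0)).1`, the form `K du` equals `K U'(X) dX` without a `dY`
term, and `U'` is as regular as `Φ`. -/
theorem contDiffAt_pulledBackForm (hn : n = ∞ ∨ n = ω) {Φ : ℝ × ℝ → ℝ × ℝ}
    {K : ℝ × ℝ → E → ℝ} (hΦ : ContDiffAt ℝ n Φ 0) (hΦ0 : Φ 0 = 0) {δ : E}
    (hK : ContDiffAt ℝ n (fun w : (ℝ × ℝ) × E => K w.1 w.2) (0, δ)) :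
    ContDiffAt ℝ n (pulledBackForm Φ K) ((0, δ), 0) := by
  have hU : ContDiffAt ℝ n (fun x : ℝ => (Φ (x, 0)).1) 0 := contDiffAt_fst.comp (0 : ℝ)
    (ContDiffAt.comp (g := Φ) (0 : ℝ) hΦ (contDiffAt_id.prodMk contDiffAt_const))
  have hU' : ContDiffAt ℝ n (fun x => fderiv ℝ (fun x : ℝ => (Φ (x, 0)).1) x 1) 0 :=
    (hU.fderiv_right (add_one_le_of_infty_or_omega hn)).clm_apply contDiffAt_const
  refine ContDiffAt.mul ?_ ?_
  · refine ContDiffAt.comp (g := fun w : (ℝ × ℝ) × E => K w.1 w.2)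
      (f := fun w : (ℝ × E) × ℝ => (((Φ (w.1.1, 0)).1, (Φ (w.1.1, w.2)).2), w.1.2)) _ ?_ ?_
    · simpa [Prod.mk_zero_zero, hΦ0] using hK
    · refine ContDiffAt.prodMk (ContDiffAt.prodMk ?_ ?_) (by fun_prop)
      · exact ContDiffAt.comp (g := fun x : ℝ => (Φ (x, 0)).1)
          (f := fun w : (ℝ × E) × ℝ => w.1.1) _ hU (by fun_prop)
      · exact contDiffAt_snd.comp _ (ContDiffAt.comp (g := Φ)
          (f := fun w : (ℝ × E) × ℝ => (w.1.1, w.2)) _ hΦ (by fun_prop))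
  · exact ContDiffAt.comp (g := fun x => fderiv ℝ (fun x : ℝ => (Φ (x, 0)).1) x 1)
      (f := fun w : (ℝ × E) × ℝ => w.1.1) _ hU' (by fun_prop)

/-- Twice the odd part of a function in its last variable. -/
def oddPart {E' : Type} (f : E' × ℝ → ℝ) (w : E' × ℝ) : ℝ := f w - f (w.1, -w.2)

theorem hadamardQuotient_oddPart_neg {E' : Type} (f : E' × ℝ → ℝ) (x : E') (y : ℝ) :
    hadamardQuotient (oddPart f) (x, -y) = hadamardQuotient (oddPart f) (x, y) := by
  have h1 : ∀ a, deriv (fun y => oddPart f (x, y)) (-a) = deriv (fun y => oddPart f (x, y)) a := by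
    intro a
    have h2 : (fun y => oddPart f (x, y)) = fun y => -oddPart f (x, -y) := by
      ext y
      simp [oddPart]
    have h3 := deriv_comp_neg (fun y => oddPart f (x, y)) a
    conv_rhs => rw [h2]
    rw [deriv.fun_neg, h3, neg_neg]
  simp only [hadamardQuotient, mul_neg, h1]

/-- The Melnikov function divided by `ρ^{p+1}`, as a function of `ρ = h^{1/(2p)}`. -/
def scaledMelnikov {E : Type} (p : ℕ) (f : (ℝ × E) × ℝ → ℝ) (w : ℝ × E) : ℝ :=
  ∫ s in (-1 : ℝ)..1, √(1 - s ^ (2 * p)) *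
    hadamardQuotient (oddPart f) ((w.1 * s, w.2), w.1 ^ p * √(1 - s ^ (2 * p)))

/-- The substitution `s ↦ -s` compensates the sign in `ρ s`. The sign of `(-ρ)^p`, present for odd
`p`, is harmless because the quotient of an odd function by `y` is even in `y`. -/
theorem scaledMelnikov_neg {E : Type} (p : ℕ) (f : (ℝ × E) × ℝ → ℝ) (ρ : ℝ) (δ : E) :
    scaledMelnikov p f (-ρ, δ) = scaledMelnikov p f (ρ, δ) := by
  have h1 := intervalIntegral.integral_comp_neg (a := -1) (b := 1)
    (fun s : ℝ => √(1 - s ^ (2 * p)) *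
      hadamardQuotient (oddPart f) ((-ρ * s, δ), (-ρ) ^ p * √(1 - s ^ (2 * p))))
  rw [neg_neg] at h1
  simp only [scaledMelnikov]
  rw [← h1]
  refine intervalIntegral.integral_congr fun s _ => ?_
  simp only [(even_two_mul p).neg_pow, neg_mul_neg]
  congr 1
  rcases Nat.even_or_odd p with hp | hp
  · rw [hp.neg_pow]
  · rw [hp.neg_pow, neg_mul, hadamardQuotient_oddPart_neg]

/-- The root `√(1 - s^{2p})` is only continuous at `s = ±1`, but it belongs to the arc `σ` and not
to the parameters. At `ρ = 0` the quotient is evaluated only at `((0, δ), 0)`, because `p ≥ 1` makes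
`0^p = 0`. -/
theorem contDiffAt_scaledMelnikov (hn : n = ∞ ∨ n = ω) {p : ℕ} (hp : 1 ≤ p)
    {f : (ℝ × E) × ℝ → ℝ} {δ : E} (hf : ContDiffAt ℝ n f ((0, δ), 0)) :
    ContDiffAt ℝ n (scaledMelnikov p f) (0, δ) := by
  have hodd : ContDiffAt ℝ n (oddPart f) ((0, δ), 0) := by
    refine hf.sub ?_
    refine ContDiffAt.comp (g := f) (f := fun w : (ℝ × E) × ℝ => (w.1, -w.2)) _ ?_ (by fun_prop)
    simpa using hf
  refine contDiffAt_integral_arc (σ := fun s : ℝ => (s, √(1 - s ^ (2 * p)))) hn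
    (by norm_num) (by fun_prop) (x₀ := ((0, δ) : ℝ × E))
    (f := fun w : (ℝ × E) × (ℝ × ℝ) => w.2.2 *
      hadamardQuotient (oddPart f) ((w.1.1 * w.2.1, w.1.2), w.1.1 ^ p * w.2.2)) fun s _ => ?_
  refine ContDiffAt.mul (by fun_prop) ?_
  refine ContDiffAt.comp (g := hadamardQuotient (oddPart f))
    (f := fun w : (ℝ × E) × (ℝ × ℝ) => ((w.1.1 * w.2.1, w.1.2), w.1.1 ^ p * w.2.2)) _ ?_
    (by fun_prop)
  have hp0 : p ≠ 0 := by omega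
  simpa [hp0] using contDiffAt_hadamardQuotient hn hodd

/-- The Melnikov function near a center in normal form is `ρ^{p+1}` times an even smooth function
of `ρ = h^{1/(2p)}`. -/
theorem exists_melnikov_eq (hn : n = ∞ ∨ n = ω) {F : ℝ × ℝ → ℝ}
    (hF : ContDiffAt ℝ n F 0) {κ : ℝ} (hκ : 0 < κ)
    (hFv : (fun v : ℝ => F (0, v) - κ / 2 * v ^ 2) =O[𝓝 0] fun v => v ^ 3) {p : ℕ} (hp : 1 ≤ p)
    (hord : HasCenterOrder F p) {P Q : ℝ × ℝ → E → ℝ} {Δ : Set E} (hΔ : IsCompact Δ)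
    (hP : ∀ δ ∈ Δ, ContDiffAt ℝ n (fun w : (ℝ × ℝ) × E => P w.1 w.2) (0, δ))
    (hQ : ∀ δ ∈ Δ, ContDiffAt ℝ n (fun w : (ℝ × ℝ) × E => Q w.1 w.2) (0, δ)) :
    ∃ S : ℝ × E → ℝ, (∀ δ ∈ Δ, ContDiffAt ℝ n S (0, δ)) ∧ (∀ ρ δ, S (-ρ, δ) = S (ρ, δ)) ∧
      ∀ L : CenterFamily F (0, 0), ∀ᶠ ρ in 𝓝[>] (0 : ℝ), ∀ δ ∈ Δ,
        L.melnikov P Q (ρ ^ (2 * p)) δ = ρ ^ (p + 1) * S (ρ, δ) := by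
  have h1n := one_le_of_infty_or_omega hn
  obtain ⟨X, Y, Φ, hX, hY, hΦ, hX0, hY0, hev⟩ := exists_normal_coordinates hn hF hκ hFv hp hord
  have hev : ∀ᶠ z in 𝓝 (0 : ℝ × ℝ), NormalCoordinatesAt F p X Y Φ z :=
    hev.mono fun z hz => ⟨hz.1, hz.2.1, hz.2.2.1, hz.2.2.2.1, hz.2.2.2.2⟩
  have hF0 : F (0, 0) = 0 := by simpa using (isBigO_iff.1 hFv).choose_spec.self_of_nhds
  have hΦ0 : Φ 0 = 0 := by
    have := hev.self_of_nhds.inverse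
    simpa [hX0, hY0, Prod.mk_zero_zero] using this
  let K := reducedForm P Q
  let f := pulledBackForm Φ K
  have hf : ∀ δ ∈ Δ, ContDiffAt ℝ n f ((0, δ), 0) := fun δ hδ =>
    contDiffAt_pulledBackForm hn hΦ hΦ0 (contDiffAt_reducedForm hn (hP δ hδ) (hQ δ hδ))
  refine ⟨scaledMelnikov p f, fun δ hδ => contDiffAt_scaledMelnikov hn hp (hf δ hδ),
    scaledMelnikov_neg p f, fun L => ?_⟩
  -- conditions near the origin
  have hU : ContDiffAt ℝ n (fun x : ℝ => (Φ (x, 0)).1) 0 := contDiffAt_fst.comp (0 : ℝ)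
    (ContDiffAt.comp (g := Φ) (0 : ℝ) hΦ (contDiffAt_id.prodMk contDiffAt_const))
  have hfst : Tendsto (fun z : ℝ × ℝ => z.1) (𝓝 0) (𝓝 0) := continuous_fst.tendsto 0
  have hXt : Tendsto (fun z : ℝ × ℝ => X z.1) (𝓝 0) (𝓝 0) := by
    have := hX.continuousAt.tendsto.comp hfst
    rwa [hX0] at this
  have E1 : ∀ᶠ z in 𝓝 (0 : ℝ × ℝ), NormalCoordinatesAt F p X Y Φ z ∧ ContDiffAt ℝ 1 F z ∧
      ContDiffAt ℝ 1 X z.1 ∧ ContDiffAt ℝ 1 Y z ∧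
      ContDiffAt ℝ 1 (fun x : ℝ => (Φ (x, 0)).1) (X z.1) := by
    filter_upwards [hev, (hF.of_le h1n).eventually (by simp),
      hfst.eventually ((hX.of_le h1n).eventually (by simp)),
      (hY.of_le h1n).eventually (by simp), hXt.eventually ((hU.of_le h1n).eventually (by simp))]
      with z h1 h2 h3 h4 h5
    exact ⟨h1, h2, h3, h4, h5⟩
  -- Compactness of `Δ` provides one neighbourhood of the origin that serves all `δ`.
  have E2 : ∀ᶠ z in 𝓝 (0 : ℝ × ℝ), ∀ δ ∈ Δ,
      ContDiffAt ℝ 1 (fun w : (ℝ × ℝ) × E => primitiveY P w.1 w.2) (z, δ) ∧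
      ContDiffAt ℝ 1 (fun w : (ℝ × ℝ) × E => P w.1 w.2) (z, δ) ∧
      ContDiffAt ℝ 1 (fun w : (ℝ × ℝ) × E => Q w.1 w.2) (z, δ) := by
    refine hΔ.eventually_forall_of_forall_eventually fun δ hδ => ?_
    filter_upwards [((contDiffAt_primitiveY hn (hP δ hδ)).of_le h1n).eventually (by simp),
      ((hP δ hδ).of_le h1n).eventually (by simp), ((hQ δ hδ).of_le h1n).eventually (by simp)]
      with w h1 h2 h3
    exact ⟨h1, h2, h3⟩
  have E3 : ∀ᶠ q in 𝓝 (0 : ℝ × ℝ), ∀ δ ∈ Δ, ContDiffAt ℝ 1 f ((q.1, δ), q.2) ∧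
      oddPart f ((q.1, δ), q.2) = q.2 * hadamardQuotient (oddPart f) ((q.1, δ), q.2) := by
    refine hΔ.eventually_forall_of_forall_eventually (P := fun (q : ℝ × ℝ) δ =>
      ContDiffAt ℝ 1 f ((q.1, δ), q.2) ∧
      oddPart f ((q.1, δ), q.2) = q.2 * hadamardQuotient (oddPart f) ((q.1, δ), q.2)) fun δ hδ => ?_
    have ht : Tendsto (fun w : (ℝ × ℝ) × E => ((w.1.1, w.2), w.1.2)) (𝓝 (0, δ))
        (𝓝 (((0, δ), 0) : (ℝ × E) × ℝ)) :=
      (Continuous.tendsto (by fun_prop) ((0, δ) : (ℝ × ℝ) × E))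
    have hodd : ContDiffAt ℝ n (oddPart f) ((0, δ), 0) := by
      refine (hf δ hδ).sub ?_
      refine ContDiffAt.comp (g := f) (f := fun w : (ℝ × E) × ℝ => (w.1, -w.2)) _ ?_ (by fun_prop)
      simpa using hf δ hδ
    exact ht.eventually ((((hf δ hδ).of_le h1n).eventually (by simp)).and
      (eventually_eq_mul_hadamardQuotient (hodd.of_le h1n)
        (Eventually.of_forall fun x => by simp [oddPart])))
  obtain ⟨η, hη, hηE⟩ := Metric.eventually_nhds_iff_ball.1 (E1.and E2)
  obtain ⟨η', hη', hηE'⟩ := Metric.eventually_nhds_iff_ball.1 E3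
  have hLs := L.shrinks (Metric.ball 0 η) (Metric.ball_mem_nhds _ hη)
  rw [hF0] at hLs
  have hLβ : ∀ᶠ h in 𝓝[>] (0 : ℝ), h ∈ Ioo 0 L.β := Ioo_mem_nhdsGT L.β_pos
  have hpow : Tendsto (fun ρ : ℝ => ρ ^ (2 * p)) (𝓝[>] 0) (𝓝[>] 0) := by
    refine tendsto_nhdsWithin_iff.2 ⟨?_, ?_⟩
    · have : Tendsto (fun ρ : ℝ => ρ ^ (2 * p)) (𝓝 0) (𝓝 (0 ^ (2 * p))) :=
        (continuous_pow (2 * p)).tendsto 0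
      rw [zero_pow (by omega)] at this
      exact this.mono_left nhdsWithin_le_nhds
    · filter_upwards [self_mem_nhdsWithin] with ρ hρ
      exact pow_pos (mem_Ioi.1 hρ) _
  filter_upwards [hpow.eventually hLs, hpow.eventually hLβ,
    Ioo_mem_nhdsGT (lt_min one_pos hη')] with ρ h1 h2 h3 δ hδ
  have hρ : 0 < ρ := h3.1
  have hρ1 : ρ < 1 := h3.2.trans_le (min_le_left _ _)
  have hρη : ρ < η' := h3.2.trans_le (min_le_right _ _)
  -- Thus the box `|X| ≤ ρ`, `|Y| ≤ ρ^p` lies in the ball of radius `η'`.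
  have hρp : ρ ^ p ≤ ρ := pow_le_of_le_one hρ.le hρ1.le (by omega)
  have hγ : IsPeriodicOrbit F (ρ ^ (2 * p)) (L.orbit (ρ ^ (2 * p))) (L.period (ρ ^ (2 * p))) :=
    L.isPeriodicOrbit _ (by simpa [hF0] using h2)
  set γ := L.orbit (ρ ^ (2 * p))
  set T := L.period (ρ ^ (2 * p))
  have hball : ∀ t, γ t ∈ Metric.ball (0 : ℝ × ℝ) η := fun t => h1 (mem_range_self t)
  have hslice : ∀ {G : ℝ × ℝ → E → ℝ} {z : ℝ × ℝ},
      ContDiffAt ℝ 1 (fun w : (ℝ × ℝ) × E => G w.1 w.2) (z, δ) →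
      ContDiffAt ℝ 1 (fun z => G z δ) z := fun {G z} hG =>
    ContDiffAt.comp (g := fun w : (ℝ × ℝ) × E => G w.1 w.2) z hG
      (contDiffAt_id.prodMk contDiffAt_const)
  have hFc : ∀ t, ContDiffAt ℝ 1 F (γ t) := fun t => (hηE _ (hball t)).1.2.1
  have hN : ∀ t, NormalCoordinatesAt F p X Y Φ (γ t) := fun t => (hηE _ (hball t)).1.1
  have hred : L.melnikov P Q (ρ ^ (2 * p)) δ = ∫ t in (0 : ℝ)..T, K (γ t) δ * partialY F (γ t) :=
    integral_eq_integral_reducedForm hγ hball hFc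
      (fun z hz => (hslice ((hηE z hz).2 δ hδ).2.1).continuousAt)
      (fun z hz => (hslice ((hηE z hz).2 δ hδ).2.2).continuousAt)
      (fun t => hslice ((hηE _ (hball t)).2 δ hδ).1)
  let x' : ℝ → ℝ := fun t => deriv X (γ t).1 * partialY F (γ t)
  have hx' : ∀ t, HasDerivAt (fun t => X (γ t).1) (x' t) t := fun t =>
    (((hηE _ (hball t)).1.2.2.1.differentiableAt (by simp)).hasDerivAt).comp t
      (hγ.hasDerivAt_fst t)
  have hx'c : Continuous x' := by
    refine continuous_iff_continuousAt.2 fun t => ContinuousAt.mul ?_ ?_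
    · have h4 : ContinuousAt (deriv X) (γ t).1 :=
        ((hηE _ (hball t)).1.2.2.1.continuousAt_fderiv (by simp)).clm_apply continuousAt_const
      exact ContinuousAt.comp (f := fun t => (γ t).1) h4
        (continuous_fst.comp hγ.continuous).continuousAt
    · exact ContinuousAt.comp (g := partialY F)
        (((hFc t).continuousAt_fderiv (by simp)).clm_apply continuousAt_const)
        hγ.continuous.continuousAt
  have hx'p : Function.Periodic x' T := fun t => by simp only [x', hγ.closed t]
  have hfx : ∀ t, K (γ t) δ * partialY F (γ t) = f ((X (γ t).1, δ), Y (γ t)) * x' t := fun t => by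
    have h4 : ∀ t, (Φ (X (γ t).1, 0)).1 = (γ t).1 := fun t => (hN t).inverse_fst
    have h5 : ((Φ (X (γ t).1, 0)).1, (Φ (X (γ t).1, Y (γ t))).2) = γ t := by
      rw [h4, (hN t).inverse]
    have h6 := (((hηE _ (hball t)).1.2.2.2.2.differentiableAt (by simp)).hasDerivAt).comp t (hx' t)
    -- Differentiating `U(X(u(t))) = u(t)` along the orbit expresses `u' = F_v` as `U'(X)` times the
    -- derivative of `X`.
    have h7 : partialY F (γ t) = deriv (fun x => (Φ (x, 0)).1) (X (γ t).1) * x' t := by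
      refine (hγ.hasDerivAt_fst t).unique (h6.congr_of_eventuallyEq ?_)
      exact Eventually.of_forall fun t => (h4 t).symm
    simp only [f, pulledBackForm, h5]
    rw [mul_assoc, ← h7]
  have hbox : ∀ x y, |x| ≤ ρ → |y| ≤ ρ ^ p → ((x, y) : ℝ × ℝ) ∈ Metric.ball (0 : ℝ × ℝ) η' := by
    intro x y hx hy
    rw [mem_ball_zero_iff, Prod.norm_def]
    exact max_lt (hx.trans_lt hρη) ((hy.trans hρp).trans_lt hρη)
  have hfc : ∀ x y, |x| ≤ ρ → |y| ≤ ρ ^ p →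
      ContinuousAt (fun q : ℝ × ℝ => f ((q.1, δ), q.2)) (x, y) := fun x y hx hy =>
    ContinuousAt.comp (g := f) (f := fun q : ℝ × ℝ => ((q.1, δ), q.2))
      (((hηE' _ (hbox x y hx hy)) δ hδ).1.continuousAt) (by fun_prop)
  rw [hred]
  simp only [hfx]
  rw [integral_orbit hp hρ hγ hN (fun t => (hηE _ (hball t)).1.2.2.2.1.continuousAt) hfc hx' hx'c
    hx'p, pow_succ', mul_assoc]
  congr 1
  simp only [scaledMelnikov]
  rw [← intervalIntegral.integral_const_mul]
  refine intervalIntegral.integral_congr fun s hs => ?_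
  rw [uIcc_of_le (by norm_num)] at hs
  have hs1 : |s| ≤ 1 := abs_le.2 hs
  have hmem := hbox (ρ * s) (ρ ^ p * √(1 - s ^ (2 * p))) (by
      rw [abs_mul, abs_of_pos hρ]
      exact mul_le_of_le_one_right hρ.le hs1) (by
      rw [abs_of_nonneg (by positivity)]
      refine mul_le_of_le_one_right (by positivity) (Real.sqrt_le_one.2 ?_)
      have : 0 ≤ s ^ (2 * p) := (even_two_mul p).pow_nonneg s
      linarith)
  have h8 := ((hηE' _ hmem) δ hδ).2
  simp only [oddPart] at h8 ⊢
  rw [h8]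
  ring

end Reduction

/-! ### Taylor expansion of even functions, uniformly in the parameter. -/

section Expansion

variable {E : Type} [NormedAddCommGroup E] [NormedSpace ℝ E] {Δ : Set E} {S : ℝ × E → ℝ}

theorem contDiffAt_iteratedDeriv_fst (k : ℕ) {w : ℝ × E} (hS : ContDiffAt ℝ ∞ S w) :
    ContDiffAt ℝ ∞ (fun w : ℝ × E => iteratedDeriv k (fun ρ => S (ρ, w.2)) w.1) w := by
  induction k with
  | zero => simpa using hS
  | succ k ih =>
    have h1 := contDiffAt_deriv_snd (Or.inl rfl) (z := (w.2, w.1))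
      (h := fun z : E × ℝ => iteratedDeriv k (fun ρ => S (ρ, z.1)) z.2)
      (ContDiffAt.comp (f := fun z : E × ℝ => (z.2, z.1)) (w.2, w.1) ih (by fun_prop))
    have h2 := ContDiffAt.comp (f := fun w : ℝ × E => (w.2, w.1)) w h1 (by fun_prop)
    simp only [iteratedDeriv_succ]
    exact h2

theorem iteratedDeriv_odd_eq_zero {f : ℝ → ℝ} (hf : ∀ x, f (-x) = f x) (j : ℕ) :
    iteratedDeriv (2 * j + 1) f 0 = 0 := by
  have h1 := iteratedDeriv_comp_neg (2 * j + 1) f 0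
  simp only [hf, neg_zero, (odd_two_mul_add_one j).neg_one_pow, neg_smul, one_smul] at h1
  linarith

theorem sum_range_two_mul (a : ℕ → ℝ) (ha : ∀ j, a (2 * j + 1) = 0) (N : ℕ) :
    ∑ k ∈ Finset.range (2 * N), a k = ∑ j ∈ Finset.range N, a (2 * j) := by
  induction N with
  | zero => simp
  | succ N ih =>
    rw [Nat.mul_succ, Finset.sum_range_succ, Finset.sum_range_succ, ih, ha, add_zero,
      Finset.sum_range_succ]

/-- The `j`-th coefficient of the expansion of an even function of `ρ` in powers of `ρ²`. -/
def evenCoeff {E : Type} (S : ℝ × E → ℝ) (j : ℕ) (δ : E) : ℝ :=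
  ((2 * j).factorial : ℝ)⁻¹ * iteratedDeriv (2 * j) (fun ρ => S (ρ, δ)) 0

/-- Taylor's formula of order `2N` in `ρ`: the odd terms vanish, and the derivative in the remainder
is bounded near `{0} × Δ` by compactness. -/
theorem exists_taylor_bound (hΔ : IsCompact Δ) (hS : ∀ δ ∈ Δ, ContDiffAt ℝ ∞ S (0, δ))
    (heven : ∀ ρ δ, S (-ρ, δ) = S (ρ, δ)) (N : ℕ) :
    ∃ C, ∀ᶠ ρ in 𝓝[>] (0 : ℝ), ∀ δ ∈ Δ,
      |S (ρ, δ) - ∑ j ∈ Finset.range N, evenCoeff S j δ * ρ ^ (2 * j)| ≤ C * ρ ^ (2 * N) := by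
  let D : ℝ × E → ℝ := fun w => iteratedDeriv (2 * N) (fun ρ => S (ρ, w.2)) w.1
  have hD : ∀ δ ∈ Δ, ContDiffAt ℝ ∞ D (0, δ) := fun δ hδ =>
    contDiffAt_iteratedDeriv_fst (2 * N) (hS δ hδ)
  obtain ⟨C, hC⟩ := hΔ.exists_bound_of_continuousOn (f := fun δ => D (0, δ)) fun δ hδ =>
    (ContinuousAt.comp (f := fun δ : E => ((0 : ℝ), δ)) (hD δ hδ).continuousAt
      (by fun_prop)).continuousWithinAt
  have h1 : ∀ᶠ ρ in 𝓝 (0 : ℝ), ∀ δ ∈ Δ, |D (ρ, δ)| ≤ C + 1 ∧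
      ContDiffAt ℝ (2 * N : ℕ) S (ρ, δ) := by
    refine hΔ.eventually_forall_of_forall_eventually fun δ hδ => ?_
    have h2 : ‖D (0, δ)‖ < C + 1 := (hC δ hδ).trans_lt (lt_add_one C)
    filter_upwards [(hD δ hδ).continuousAt.norm.eventually (gt_mem_nhds h2),
      (contDiffAt_infty.1 (hS δ hδ) (2 * N)).eventually
        (WithTop.coe_injective.ne (ENat.natCast_ne_top _))] with w h3 h4
    exact ⟨le_of_lt h3, h4⟩
  obtain ⟨η, hη, hηE⟩ := Metric.eventually_nhds_iff_ball.1 h1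
  have hmem : ∀ {y : ℝ}, 0 ≤ y → y < η → y ∈ Metric.ball (0 : ℝ) η := fun h0 h => by
    simpa [abs_of_nonneg h0] using h
  refine ⟨C + 1, ?_⟩
  filter_upwards [Ioo_mem_nhdsGT hη] with ρ hρ δ hδ
  let f : ℝ → ℝ := fun ρ => S (ρ, δ)
  have hf : ∀ y ∈ Icc 0 ρ, ContDiffAt ℝ (2 * N : ℕ) f y := fun y hy =>
    ContDiffAt.comp (g := S) y (hηE y (hmem hy.1 (hy.2.trans_lt hρ.2)) δ hδ).2
      (contDiffAt_id.prodMk contDiffAt_const)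
  have hfD : ∀ y ∈ Icc 0 ρ, |iteratedDeriv (2 * N) f y| ≤ C + 1 := fun y hy =>
    (hηE y (hmem hy.1 (hy.2.trans_lt hρ.2)) δ hδ).1
  -- The remainder estimate uses a Taylor polynomial of degree `m = 2N - 1`; for `N = 0` the claim
  -- is the bound on `S` itself.
  rcases Nat.eq_zero_or_pos N with rfl | hN
  · simpa [f] using hfD ρ ⟨hρ.1.le, le_rfl⟩
  obtain ⟨m, hm⟩ : ∃ m, 2 * N = m + 1 := ⟨2 * N - 1, by omega⟩
  have hud : UniqueDiffOn ℝ (Icc 0 ρ) := uniqueDiffOn_Icc hρ.1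
  have hT := taylor_mean_remainder_bound (f := f) (a := 0) (b := ρ) (C := C + 1) (x := ρ) (n := m)
    hρ.1.le (fun y hy => by
      have := (hf y hy).contDiffWithinAt (s := Icc 0 ρ)
      rw [hm] at this
      exact_mod_cast this) ⟨hρ.1.le, le_rfl⟩ (fun y hy => by
      rw [← hm, iteratedDerivWithin_eq_iteratedDeriv hud (hf y hy) hy]
      exact hfD y hy)
  have hsum : taylorWithinEval f m (Icc 0 ρ) 0 ρ =
      ∑ j ∈ Finset.range N, evenCoeff S j δ * ρ ^ (2 * j) := by
    rw [taylor_within_apply, ← hm]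
    have h2 : ∀ k ∈ Finset.range (2 * N), (((k.factorial : ℝ))⁻¹ * (ρ - 0) ^ k) •
        iteratedDerivWithin k f (Icc 0 ρ) 0 =
        ((k.factorial : ℝ))⁻¹ * iteratedDeriv k f 0 * ρ ^ k := by
      intro k hk
      have h0 : (0 : ℝ) ∈ Icc 0 ρ := ⟨le_rfl, hρ.1.le⟩
      rw [iteratedDerivWithin_eq_iteratedDeriv hud ((hf 0 h0).of_le (by
        exact_mod_cast (Finset.mem_range.1 hk).le)) h0, sub_zero, smul_eq_mul]
      ring
    rw [Finset.sum_congr rfl h2, sum_range_two_mul _ (fun j => by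
      rw [iteratedDeriv_odd_eq_zero (fun x => heven x δ)]; simp)]
    rfl
  rw [hsum, ← hm, sub_zero, Real.norm_eq_abs] at hT
  refine hT.trans ?_
  have hC0 : 0 ≤ C + 1 := (abs_nonneg _).trans (hfD ρ ⟨hρ.1.le, le_rfl⟩)
  refine div_le_self (mul_nonneg hC0 (pow_nonneg hρ.1.le _)) ?_
  exact_mod_cast Nat.one_le_iff_ne_zero.2 (Nat.factorial_ne_zero m)

/-- Near a point where `S` is analytic, `S` is the sum of its Taylor series in the first variable. -/
theorem eventually_hasSum_of_analyticAt {δ₀ : E} (hS : AnalyticAt ℝ S (0, δ₀)) :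
    ∀ᶠ w in 𝓝 ((0, δ₀) : ℝ × E),
      HasSum (fun k => ((k.factorial : ℝ))⁻¹ * iteratedDeriv k (fun ρ => S (ρ, w.2)) 0 * w.1 ^ k)
        (S w) := by
  obtain ⟨q, r, hq⟩ := hS
  obtain ⟨r₁, hr₁, hr₁r⟩ := ENNReal.lt_iff_exists_nnreal_btwn.1 hq.r_pos
  have hr₁' : 0 < r₁ := by exact_mod_cast hr₁
  have hr₂ : 0 < r₁ / 2 := half_pos hr₁'
  filter_upwards [Metric.ball_mem_nhds ((0, δ₀) : ℝ × E) (NNReal.coe_pos.2 hr₂)] with w hw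
  obtain ⟨ρ, δ⟩ := w
  have hw' : |ρ| < (r₁ / 2 : NNReal) ∧ ‖δ - δ₀‖ < (r₁ / 2 : NNReal) := by
    rw [mem_ball_iff_norm, Prod.norm_def, max_lt_iff] at hw
    simpa using hw
  -- The series is recentred at `(0, δ)` and restricted to the `ρ`-line. Half of `r₁` bounds the
  -- shift and the other half bounds `ρ`, so one neighbourhood works for all `δ` near `δ₀`.
  let y : ℝ × E := (0, δ - δ₀)
  have hy : ‖y‖₊ < r₁ / 2 := by
    rw [← NNReal.coe_lt_coe]
    simpa [y, Prod.norm_def] using hw'.2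
  have hyr : (‖y‖₊ : ENNReal) < r :=
    (ENNReal.coe_lt_coe.2 (hy.trans (half_lt_self hr₁'))).trans hr₁r
  have h1 := hq.changeOrigin hyr
  have h2 : ((0, δ₀) : ℝ × E) + y = (0, δ) := by simp [y]
  rw [h2] at h1
  have h3 := h1.comp_sub (-(0, δ))
  have h4 : ((0, δ) : ℝ × E) + -(0, δ) = ContinuousLinearMap.inl ℝ ℝ E 0 := by simp
  rw [h4] at h3
  have h5 := h3.compContinuousLinearMap
  have h6 : (fun z : ℝ × E => S (z - -(0, δ))) ∘ (ContinuousLinearMap.inl ℝ ℝ E) =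
      fun ρ => S (ρ, δ) := by
    ext ρ
    simp
  rw [h6] at h5
  have hρ : ρ ∈ Metric.eball (0 : ℝ) ((r - ‖y‖₊) / ‖ContinuousLinearMap.inl ℝ ℝ E‖ₑ) := by
    rw [mem_eball_zero_iff]
    have h7 : ‖ρ‖ₑ < ((r₁ / 2 : NNReal) : ENNReal) := by
      rw [enorm_eq_nnnorm, ENNReal.coe_lt_coe, ← NNReal.coe_lt_coe]
      exact hw'.1
    refine h7.trans_le ?_
    have h8 : ‖ContinuousLinearMap.inl ℝ ℝ E‖ₑ ≤ 1 := by
      rw [enorm_eq_nnnorm, ENNReal.coe_le_one_iff, ← NNReal.coe_le_coe]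
      exact ContinuousLinearMap.norm_inl_le_one ℝ ℝ E
    have h9 : ((r₁ / 2 : NNReal) : ENNReal) ≤ r - ‖y‖₊ := by
      refine ENNReal.le_sub_of_add_le_right ENNReal.coe_ne_top ?_
      refine le_trans ?_ hr₁r.le
      rw [← ENNReal.coe_add, ENNReal.coe_le_coe]
      calc r₁ / 2 + ‖y‖₊ ≤ r₁ / 2 + r₁ / 2 := by gcongr
        _ = r₁ := add_halves r₁
    refine h9.trans ?_
    calc r - ‖y‖₊ = (r - ‖y‖₊) / 1 := by simp
      _ ≤ _ := ENNReal.div_le_div_left h8 _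
  have h10 := h5.hasSum_iteratedFDeriv hρ
  rw [zero_add] at h10
  refine h10.congr_fun fun k => ?_
  rw [iteratedFDeriv_apply_eq_iteratedDeriv_mul_prod]
  simp only [Finset.prod_const, Finset.card_univ, Fintype.card_fin, smul_eq_mul]
  ring

/-- An even function has no odd Taylor coefficients, so the sum may be restricted to the even
indices. -/
theorem hasSum_evenCoeff {E : Type} {S : ℝ × E → ℝ} (heven : ∀ ρ δ, S (-ρ, δ) = S (ρ, δ)) {ρ : ℝ} {δ : E}
    (h : HasSum (fun k => ((k.factorial : ℝ))⁻¹ * iteratedDeriv k (fun ρ => S (ρ, δ)) 0 * ρ ^ k)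
      (S (ρ, δ))) :
    HasSum (fun j => evenCoeff S j δ * ρ ^ (2 * j)) (S (ρ, δ)) := by
  have hinj : Function.Injective fun j : ℕ => 2 * j := fun i j hij => by simpa using hij
  refine (hinj.hasSum_iff fun k hk => ?_).2 h
  rcases Nat.even_or_odd' k with ⟨j, rfl | rfl⟩
  · exact absurd ⟨j, rfl⟩ hk
  · rw [iteratedDeriv_odd_eq_zero (fun x => heven x δ)]
    simp

/-- A function `M(h, δ)` with `M(ρ^{2p}, δ) = ρ^{p+1} S(ρ, δ)`, where `S` is even in `ρ`, has an
expansion in powers of `h^{1/p}`. -/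
theorem isExpansion_of_even {n : WithTop ℕ∞} (hn : n = ∞ ∨ n = ω) (hΔ : IsCompact Δ)
    (hS : ∀ δ ∈ Δ, ContDiffAt ℝ n S (0, δ)) (heven : ∀ ρ δ, S (-ρ, δ) = S (ρ, δ)) {p : ℕ}
    (hp : 1 ≤ p) {M : ℝ → E → ℝ}
    (hM : ∀ᶠ ρ in 𝓝[>] (0 : ℝ), ∀ δ ∈ Δ, M (ρ ^ (2 * p)) δ = ρ ^ (p + 1) * S (ρ, δ)) :
    IsExpansion (n = ω) (fun s => s ^ (((p : ℝ) + 1) / (2 * p))) (fun j s => s ^ ((j : ℝ) / p)) 0 Δ M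
      (evenCoeff S) := by
  have hp0 : (0 : ℝ) < p := by exact_mod_cast hp
  have hlead : ∀ {ρ : ℝ}, 0 < ρ → (ρ ^ (2 * p)) ^ (((p : ℝ) + 1) / (2 * p)) = ρ ^ (p + 1) := by
    intro ρ hρ
    rw [← Real.rpow_natCast ρ (2 * p), ← Real.rpow_mul hρ.le, ← Real.rpow_natCast ρ (p + 1)]
    congr 1
    push_cast
    field_simp
  have hterm : ∀ {ρ : ℝ}, 0 < ρ → ∀ j : ℕ, (ρ ^ (2 * p)) ^ ((j : ℝ) / p) = ρ ^ (2 * j) := by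
    intro ρ hρ j
    rw [← Real.rpow_natCast ρ (2 * p), ← Real.rpow_mul hρ.le, ← Real.rpow_natCast ρ (2 * j)]
    congr 1
    push_cast
    field_simp
  -- Passage from small `ρ` to small `h` by `ρ = h^{1/(2p)}`, which maps `(0, r^{2p})` into `(0,
  -- r)`.
  have huse : ∀ {A : ℝ → Prop}, (∀ᶠ ρ in 𝓝[>] (0 : ℝ), A (ρ ^ (2 * p))) →
      ∃ r : ℝ, 0 < r ∧ ∀ h ∈ Ioo 0 (0 + r), A h := by
    intro A hA
    obtain ⟨r, hr, hrA⟩ := mem_nhdsGT_iff_exists_Ioo_subset.1 hA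
    refine ⟨r ^ (2 * p), pow_pos hr _, fun h hh => ?_⟩
    rw [zero_add] at hh
    have h2p : 2 * p ≠ 0 := by omega
    have h1 : (h ^ (((2 * p : ℕ) : ℝ)⁻¹)) ^ (2 * p) = h := Real.rpow_inv_natCast_pow hh.1.le h2p
    have h2 : h ^ (((2 * p : ℕ) : ℝ)⁻¹) ∈ Ioo 0 r := by
      refine ⟨Real.rpow_pos_of_pos hh.1 _, ?_⟩
      refine lt_of_pow_lt_pow_left₀ (2 * p) (le_of_lt hr) ?_
      rw [h1]
      exact hh.2
    have h3 : A ((h ^ (((2 * p : ℕ) : ℝ)⁻¹)) ^ (2 * p)) := hrA h2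
    rwa [h1] at h3
  have hSinf : ∀ δ ∈ Δ, ContDiffAt ℝ ∞ S (0, δ) := fun δ hδ => (hS δ hδ).of_le (by
    rcases hn with rfl | rfl
    · exact le_rfl
    · exact le_top)
  constructor
  · intro N
    obtain ⟨C, hC⟩ := exists_taylor_bound hΔ hSinf heven N
    obtain ⟨r, hr, hrA⟩ := huse (A := fun h => ∀ δ ∈ Δ, |M h δ - h ^ (((p : ℝ) + 1) / (2 * p)) *
        ∑ j ∈ Finset.range N, evenCoeff S j δ * h ^ ((j : ℝ) / p)|
          ≤ C * (h ^ (((p : ℝ) + 1) / (2 * p)) * h ^ ((N : ℝ) / p))) (by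
      filter_upwards [hC, hM, self_mem_nhdsWithin] with ρ h1 h2 h3 δ hδ
      have hρ : 0 < ρ := h3
      simp only [hlead hρ, hterm hρ]
      rw [h2 δ hδ, ← mul_sub, abs_mul, abs_of_pos (pow_pos hρ _)]
      calc ρ ^ (p + 1) * |S (ρ, δ) - ∑ j ∈ Finset.range N, evenCoeff S j δ * ρ ^ (2 * j)|
          ≤ ρ ^ (p + 1) * (C * ρ ^ (2 * N)) := by
            gcongr
            exact h1 δ hδ
        _ = _ := by ring)
    refine ⟨C, r, hr, fun δ hδ h hh => ?_⟩
    simpa only [sub_zero] using hrA h hh δ hδ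
  · rintro rfl
    have h1 : ∀ᶠ ρ in 𝓝 (0 : ℝ), ∀ δ ∈ Δ,
        HasSum (fun j => evenCoeff S j δ * ρ ^ (2 * j)) (S (ρ, δ)) := by
      refine hΔ.eventually_forall_of_forall_eventually fun δ hδ => ?_
      filter_upwards [eventually_hasSum_of_analyticAt (hS δ hδ).analyticAt] with w hw
      exact hasSum_evenCoeff heven hw
    obtain ⟨r, hr, hrA⟩ := huse (A := fun h => ∀ δ ∈ Δ, ∃ s : ℝ,
        HasSum (fun j : ℕ => evenCoeff S j δ * h ^ ((j : ℝ) / p)) s ∧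
          M h δ = h ^ (((p : ℝ) + 1) / (2 * p)) * s) (by
      filter_upwards [nhdsWithin_le_nhds h1, hM, self_mem_nhdsWithin] with ρ h1 h2 h3 δ hδ
      have hρ : 0 < ρ := h3
      simp only [hlead hρ, hterm hρ]
      exact ⟨_, h1 δ hδ, h2 δ hδ⟩)
    refine ⟨r, hr, fun δ hδ h hh => ?_⟩
    simpa only [sub_zero] using hrA h hh δ hδ

end Expansion

/-! ### Effect of the change of variables and of time on orbits and on the Melnikov function. -/

/-- The linear change of variables
`u = a (x - x₀) + b (y - y₀)`, `v = c (x - x₀) + d (y - y₀)`. -/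
def newCoords (a b c d x₀ y₀ : ℝ) (z : ℝ × ℝ) : ℝ × ℝ :=
  (a * (z.1 - x₀) + b * (z.2 - y₀), c * (z.1 - x₀) + d * (z.2 - y₀))

section Transform

variable {a b c d k x₀ y₀ : ℝ} {H : ℝ × ℝ → ℝ}

theorem oldCoords_newCoords (hD : a * d - b * c ≠ 0) (z : ℝ × ℝ) :
    oldCoords a b c d x₀ y₀ (newCoords a b c d x₀ y₀ z) = z := by
  ext
  · simp only [oldCoords, newCoords]
    field_simp
    ring
  · simp only [oldCoords, newCoords]
    field_simp
    ring

theorem newCoords_oldCoords (hD : a * d - b * c ≠ 0) (w : ℝ × ℝ) :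
    newCoords a b c d x₀ y₀ (oldCoords a b c d x₀ y₀ w) = w := by
  have h : 1 / (a * d - b * c) * (a * d - b * c) = 1 := one_div_mul_cancel hD
  ext
  · simp only [oldCoords, newCoords]
    linear_combination w.1 * h
  · simp only [oldCoords, newCoords]
    linear_combination w.2 * h

theorem oldCoords_zero : oldCoords a b c d x₀ y₀ (0, 0) = (x₀, y₀) := by
  simp [oldCoords]

theorem newCoords_center : newCoords a b c d x₀ y₀ (x₀, y₀) = (0, 0) := by
  simp [newCoords]

theorem contDiff_oldCoords {n : WithTop ℕ∞} : ContDiff ℝ n (oldCoords a b c d x₀ y₀) := by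
  unfold oldCoords
  fun_prop

theorem continuous_oldCoords : Continuous (oldCoords a b c d x₀ y₀) :=
  (contDiff_oldCoords (n := 0)).continuous

theorem continuous_newCoords : Continuous (newCoords a b c d x₀ y₀) := by
  unfold newCoords
  fun_prop

theorem differentiable_newH (hH : Differentiable ℝ H) :
    Differentiable ℝ (newH a b c d k x₀ y₀ H) := by
  have h1 : Differentiable ℝ (oldCoords a b c d x₀ y₀) :=
    (contDiff_oldCoords (n := 1)).differentiable (by simp)
  exact ((hH.comp h1).sub_const _).const_mul _

theorem fderiv_apply_eq (z : ℝ × ℝ) (α β : ℝ) :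
    fderiv ℝ H z (α, β) = α * partialX H z + β * partialY H z := by
  have : ((α, β) : ℝ × ℝ) = α • (1, 0) + β • (0, 1) := by simp
  rw [this, map_add, map_smul, map_smul]
  rfl

theorem partialX_newH (hD : a * d - b * c ≠ 0) (hH : Differentiable ℝ H) (w : ℝ × ℝ) :
    partialX (newH a b c d k x₀ y₀ H) w =
      1 / k * (d * partialX H (oldCoords a b c d x₀ y₀ w)
        - c * partialY H (oldCoords a b c d x₀ y₀ w)) := by
  have h1 : HasDerivAt (fun u => oldCoords a b c d x₀ y₀ (u, w.2))
      (1 / (a * d - b * c) * d, 1 / (a * d - b * c) * (-c)) w.1 := by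
    refine HasDerivAt.prodMk ?_ ?_
    · have := ((((hasDerivAt_id w.1).const_mul d).sub_const (b * w.2)).const_mul
        (1 / (a * d - b * c))).const_add x₀
      simpa using this
    · have := ((((hasDerivAt_id w.1).const_mul (-c)).add_const (a * w.2)).const_mul
        (1 / (a * d - b * c))).const_add y₀
      simpa using this
  have h2 := (((hH _).hasFDerivAt.comp_hasDerivAt w.1 h1).sub_const (H (x₀, y₀))).const_mul
    ((a * d - b * c) / k)
  rw [(hasDerivAt_partialX (differentiable_newH hH w)).unique h2, fderiv_apply_eq]
  field_simp
  ring

theorem partialY_newH (hD : a * d - b * c ≠ 0) (hH : Differentiable ℝ H) (w : ℝ × ℝ) :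
    partialY (newH a b c d k x₀ y₀ H) w =
      1 / k * (-b * partialX H (oldCoords a b c d x₀ y₀ w)
        + a * partialY H (oldCoords a b c d x₀ y₀ w)) := by
  have h1 : HasDerivAt (fun v => oldCoords a b c d x₀ y₀ (w.1, v))
      (1 / (a * d - b * c) * (-b), 1 / (a * d - b * c) * a) w.2 := by
    refine HasDerivAt.prodMk ?_ ?_
    · have := ((((hasDerivAt_id w.2).const_mul b).const_sub (d * w.1)).const_mul
        (1 / (a * d - b * c))).const_add x₀
      simpa using this
    · have := ((((hasDerivAt_id w.2).const_mul a).const_add (-c * w.1)).const_mul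
        (1 / (a * d - b * c))).const_add y₀
      simpa using this
  have h2 := (((hH _).hasFDerivAt.comp_hasDerivAt w.2 h1).sub_const (H (x₀, y₀))).const_mul
    ((a * d - b * c) / k)
  rw [(hasDerivAt_partialY (differentiable_newH hH w)).unique h2, fderiv_apply_eq]
  field_simp

/-- A version of simplicity that is symmetric under time reversal: for `k < 0`, division by `k`
turns half-open intervals around. -/
theorem IsPeriodicOrbit.eq_of_abs_sub_lt {F : ℝ × ℝ → ℝ} {h : ℝ} {γ : ℝ → ℝ × ℝ} {T : ℝ}
    (hγ : IsPeriodicOrbit F h γ T) {s t : ℝ} (hst : |s - t| < T) (he : γ s = γ t) : s = t := by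
  have hT := hγ.period_pos
  rw [abs_lt] at hst
  rcases le_total s t with h1 | h1
  · exact hγ.eq_of_mem_Ico (t₀ := s) ⟨le_rfl, by linarith⟩ ⟨h1, by linarith⟩ he
  · exact hγ.eq_of_mem_Ico (t₀ := t) ⟨h1, by linarith⟩ ⟨le_rfl, by linarith⟩ he

theorem abs_mul_div_self (hk : k ≠ 0) (T : ℝ) : |k| * T / k = T ∨ |k| * T / k = -T := by
  rcases abs_cases k with ⟨h, _⟩ | ⟨h, _⟩
  · left
    rw [h]
    field_simp
  · right
    rw [h]
    field_simp

/-- The change of variables takes periodic orbits to periodic orbits. -/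
theorem IsPeriodicOrbit.transform (hD : a * d - b * c ≠ 0) (hk : k ≠ 0) (hH : Differentiable ℝ H)
    {h : ℝ} {γ : ℝ → ℝ × ℝ} {T : ℝ} (hγ : IsPeriodicOrbit H h γ T) :
    IsPeriodicOrbit (newH a b c d k x₀ y₀ H) ((a * d - b * c) / k * (h - H (x₀, y₀)))
      (fun τ => newCoords a b c d x₀ y₀ (γ (τ / k))) (|k| * T) where
  flow τ := by
    have h1 := (hγ.flow (τ / k)).scomp τ ((hasDerivAt_id τ).div_const k)
    have hx := HasFDerivAt.comp_hasDerivAt τ (hasFDerivAt_fst (𝕜 := ℝ)) h1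
    have hy := HasFDerivAt.comp_hasDerivAt τ (hasFDerivAt_snd (𝕜 := ℝ)) h1
    rw [partialX_newH hD hH, partialY_newH hD hH, oldCoords_newCoords hD]
    refine HasDerivAt.prodMk ?_ ?_
    · refine (((hx.sub_const x₀).const_mul a).add ((hy.sub_const y₀).const_mul b)).congr_deriv ?_
      simp
      ring
    · refine (((hx.sub_const x₀).const_mul c).add ((hy.sub_const y₀).const_mul d)).congr_deriv ?_
      simp
      ring
  period_pos := mul_pos (abs_pos.2 hk) hγ.period_pos
  closed τ := by
    simp only [add_div]
    rcases abs_mul_div_self hk T with h1 | h1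
    · rw [h1, hγ.closed]
    · rw [h1, ← sub_eq_add_neg, hγ.periodic.sub_eq]
  simple := by
    intro s hs t ht hst
    have h1 : γ (s / k) = γ (t / k) := by
      have := congrArg (oldCoords a b c d x₀ y₀) hst
      simpa only [oldCoords_newCoords hD] using this
    have h2 : |s / k - t / k| < T := by
      rw [← sub_div, abs_div, div_lt_iff₀ (abs_pos.2 hk), abs_lt]
      constructor <;> linarith [hs.1, hs.2, ht.1, ht.2, mul_comm T |k|]
    have h3 := hγ.eq_of_abs_sub_lt h2 h1
    field_simp at h3
    exact h3
  level τ := by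
    simp only [newH, oldCoords_newCoords hD, hγ.level]

theorem newH_center : newH a b c d k x₀ y₀ H (0, 0) = 0 := by
  simp [newH, oldCoords_zero]

/-- The family of periodic orbits of the transformed system. -/
def CenterFamily.transform (hD : a * d - b * c ≠ 0) (hk : k ≠ 0)
    (hDk : 0 < (a * d - b * c) / k) (hH : Differentiable ℝ H) (L : CenterFamily H (x₀, y₀)) :
    CenterFamily (newH a b c d k x₀ y₀ H) (0, 0) where
  critical := by
    have h1 : partialX H (x₀, y₀) = 0 := by simp [partialX, L.critical]
    have h2 : partialY H (x₀, y₀) = 0 := by simp [partialY, L.critical]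
    refine ContinuousLinearMap.ext fun ⟨α, β⟩ => ?_
    rw [fderiv_apply_eq, partialX_newH hD hH, partialY_newH hD hH, oldCoords_zero, h1, h2]
    simp
  β := (a * d - b * c) / k * L.β
  β_pos := mul_pos hDk L.β_pos
  orbit h τ := newCoords a b c d x₀ y₀
    (L.orbit (H (x₀, y₀) + h / ((a * d - b * c) / k)) (τ / k))
  period h := |k| * L.period (H (x₀, y₀) + h / ((a * d - b * c) / k))
  isPeriodicOrbit h hh := by
    rw [newH_center, zero_add] at hh
    have h1 := (L.isPeriodicOrbit (H (x₀, y₀) + h / ((a * d - b * c) / k))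
      ⟨lt_add_of_pos_right _ (div_pos hh.1 hDk), by
        have := (div_lt_iff₀' hDk).2 hh.2
        linarith⟩).transform (x₀ := x₀) (y₀ := y₀) hD hk hH
    rwa [add_sub_cancel_left, mul_div_cancel₀ _ hDk.ne'] at h1
  shrinks U hU := by
    rw [newH_center]
    have h1 : newCoords a b c d x₀ y₀ ⁻¹' U ∈ 𝓝 (x₀, y₀) := by
      refine continuous_newCoords.continuousAt.preimage_mem_nhds ?_
      rwa [newCoords_center]
    have h2 : Tendsto (fun h : ℝ => H (x₀, y₀) + h / ((a * d - b * c) / k)) (𝓝[>] 0)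
        (𝓝[>] (H (x₀, y₀))) := by
      refine tendsto_nhdsWithin_iff.2 ⟨?_, ?_⟩
      · have : Continuous fun h : ℝ => H (x₀, y₀) + h / ((a * d - b * c) / k) := by fun_prop
        have h3 := this.tendsto 0
        rw [zero_div, add_zero] at h3
        exact h3.mono_left nhdsWithin_le_nhds
      · filter_upwards [self_mem_nhdsWithin] with h hh
        exact lt_add_of_pos_right _ (div_pos (mem_Ioi.1 hh) hDk)
    filter_upwards [h2.eventually (L.shrinks _ h1)] with h hh
    rintro _ ⟨τ, rfl⟩
    exact hh (mem_range_self _)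
  fills := by
    have h1 : oldCoords a b c d x₀ y₀ ⁻¹' _ ∈ 𝓝 (0, 0) :=
      continuous_oldCoords.continuousAt.preimage_mem_nhds (by
        rw [oldCoords_zero]; exact L.fills)
    refine mem_of_superset h1 fun w hw => ?_
    rcases hw with hw | hw
    · left
      rw [← newCoords_oldCoords (x₀ := x₀) (y₀ := y₀) hD w, hw, newCoords_center]
    · right
      simp only [mem_iUnion] at hw ⊢
      obtain ⟨h, hh, t, ht⟩ := hw
      refine ⟨(a * d - b * c) / k * (h - H (x₀, y₀)), ?_, k * t, ?_⟩
      · rw [newH_center, zero_add]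
        refine ⟨mul_pos hDk (sub_pos.2 hh.1), mul_lt_mul_of_pos_left ?_ hDk⟩
        linarith [hh.2]
      · simp only
        rw [mul_div_cancel_left₀ _ hDk.ne', add_sub_cancel, mul_div_cancel_left₀ _ hk, ht,
          newCoords_oldCoords hD]

/-- For `k < 0` the substitution gives `k ∫_0^{-T} g`. By periodicity this is `-k ∫_0^T g`, so the
factor is `|k|` for both signs. -/
theorem integral_comp_div_periodic (hk : k ≠ 0) {g : ℝ → ℝ} {T : ℝ} (hg : Function.Periodic g T) :
    ∫ τ in (0 : ℝ)..(|k| * T), g (τ / k) = |k| * ∫ t in (0 : ℝ)..T, g t := by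
  rw [intervalIntegral.integral_comp_div _ hk, zero_div, smul_eq_mul]
  rcases abs_cases k with ⟨h, _⟩ | ⟨h, _⟩
  · rw [h, mul_div_cancel_left₀ _ hk]
  · have h1 : |k| * T / k = -T := by rw [h]; field_simp
    have h2 := hg.intervalIntegral_add_eq (-T) 0
    rw [neg_add_cancel, zero_add] at h2
    rw [h1, intervalIntegral.integral_symm, h2, h]
    ring

/-- The Melnikov functions of the original and of the transformed system. -/
theorem CenterFamily.melnikov_transform {E : Type*} (hD : a * d - b * c ≠ 0) (hk : k ≠ 0)
    (hDk : 0 < (a * d - b * c) / k) (hH : Differentiable ℝ H) (L : CenterFamily H (x₀, y₀))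
    (P Q : ℝ × ℝ → E → ℝ) {h : ℝ} (hh : h ∈ Ioo (H (x₀, y₀)) (H (x₀, y₀) + L.β)) (δ : E) :
    L.melnikov P Q h δ = Real.sign k * ((a * d - b * c) / k)⁻¹ *
      (L.transform hD hk hDk hH).melnikov (newP a b c d k x₀ y₀ P Q) (newQ a b c d k x₀ y₀ P Q)
        ((a * d - b * c) / k * (h - H (x₀, y₀))) δ := by
  have hγ := L.isPeriodicOrbit h hh
  have e1 : H (x₀, y₀) + (a * d - b * c) / k * (h - H (x₀, y₀)) / ((a * d - b * c) / k) = h := by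
    rw [mul_div_cancel_left₀ _ hDk.ne', add_sub_cancel]
  simp only [CenterFamily.melnikov, CenterFamily.transform]
  rw [e1]
  simp only [partialX_newH hD hH, partialY_newH hD hH, newP, newQ, oldCoords_newCoords hD]
  let g : ℝ → ℝ := fun t => partialY H (L.orbit h t) * Q (L.orbit h t) δ +
    partialX H (L.orbit h t) * P (L.orbit h t) δ
  have hg : Function.Periodic g (L.period h) := fun t => by simp only [g, hγ.closed t]
  have h2 := integral_comp_div_periodic hk hg
  -- The mixed terms cancel and leave the determinant. Together with the factor `|k|` from the time
  -- change, the total is `D |k| / k² = sgn(k) D/k`.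
  have h3 : ∀ τ : ℝ, 1 / k * (-b * partialX H (L.orbit h (τ / k)) +
      a * partialY H (L.orbit h (τ / k))) *
        (1 / k * (c * P (L.orbit h (τ / k)) δ + d * Q (L.orbit h (τ / k)) δ)) +
      1 / k * (d * partialX H (L.orbit h (τ / k)) - c * partialY H (L.orbit h (τ / k))) *
        (1 / k * (a * P (L.orbit h (τ / k)) δ + b * Q (L.orbit h (τ / k)) δ)) =
      (a * d - b * c) / k ^ 2 * g (τ / k) := fun τ => by
    simp only [g]
    field_simp
    ring
  simp only [h3]
  rw [intervalIntegral.integral_const_mul, h2]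
  have h4 : Real.sign k * |k| = k := by
    rcases hk.lt_or_gt with h | h
    · rw [Real.sign_of_neg h, abs_of_neg h]
      ring
    · rw [Real.sign_of_pos h, abs_of_pos h, one_mul]
  have h5 : Real.sign k * ((a * d - b * c) / k)⁻¹ *
      ((a * d - b * c) / k ^ 2 * (|k| * ∫ t in (0 : ℝ)..L.period h, g t)) =
      ((a * d - b * c) / k)⁻¹ * ((a * d - b * c) / k ^ 2) * (Real.sign k * |k|) *
        ∫ t in (0 : ℝ)..L.period h, g t := by ring
  rw [h5, h4]
  have h6 : ((a * d - b * c) / k)⁻¹ * ((a * d - b * c) / k ^ 2) * k = 1 := by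
    field_simp
  rw [h6, one_mul]

end Transform

/-! ### Rescaling of expansions, the sign of `D/k`, and the main theorem. -/

/-- Expansions are preserved by rescaling the level. -/
theorem IsExpansion.rescale {E : Type*} {A : Prop} {p : ℕ} (hp : 1 ≤ p) {Δ : Set E}
    {M M' : ℝ → E → ℝ} {B : ℕ → E → ℝ} {h₀ r₀ l σ : ℝ} (hr₀ : 0 < r₀) (hl : 0 < l)
    (hM : IsExpansion A (fun s => s ^ (((p : ℝ) + 1) / (2 * p))) (fun j s => s ^ ((j : ℝ) / p)) 0 Δ
      M' B)
    (hMM : ∀ h ∈ Ioo h₀ (h₀ + r₀), ∀ δ ∈ Δ, M h δ = σ * l⁻¹ * M' (l * (h - h₀)) δ) :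
    IsExpansion A (fun s => s ^ (((p : ℝ) + 1) / (2 * p))) (fun j s => s ^ ((j : ℝ) / p)) h₀ Δ M
      (fun j δ => σ * l ^ ((1 + 2 * (j : ℝ) - p) / (2 * p)) * B j δ) := by
  have hp0 : (0 : ℝ) < p := by exact_mod_cast hp
  -- The three factors come from the prefactor `l⁻¹`, the leading power and the `j`-th term: `-1 +
  -- (p+1)/(2p) + j/p = (1+2j-p)/(2p)`.
  have hexp : ∀ j : ℕ, l ^ ((1 + 2 * (j : ℝ) - p) / (2 * p)) =
      l⁻¹ * l ^ (((p : ℝ) + 1) / (2 * p)) * l ^ ((j : ℝ) / p) := fun j => by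
    rw [← Real.rpow_neg_one l, ← Real.rpow_add hl, ← Real.rpow_add hl]
    congr 1
    field_simp
    ring
  have hsub : ∀ {r h : ℝ}, h ∈ Ioo h₀ (h₀ + min r₀ (r / l)) →
      h ∈ Ioo h₀ (h₀ + r₀) ∧ l * (h - h₀) ∈ Ioo 0 (0 + r) := by
    intro r h hh
    have h1 : h < h₀ + r₀ := hh.2.trans_le (by gcongr; exact min_le_left _ _)
    have h2 : h < h₀ + r / l := hh.2.trans_le (by gcongr; exact min_le_right _ _)
    refine ⟨⟨hh.1, h1⟩, mul_pos hl (sub_pos.2 hh.1), ?_⟩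
    rw [zero_add, ← lt_div_iff₀' hl]
    linarith
  refine ⟨fun N => ?_, fun hA => ?_⟩
  · obtain ⟨C, r, hr, hC⟩ := hM.1 N
    refine ⟨|σ| * l⁻¹ * C * l ^ (((p : ℝ) + 1) / (2 * p)) * l ^ ((N : ℝ) / p), min r₀ (r / l),
      lt_min hr₀ (div_pos hr hl), fun δ hδ h hh => ?_⟩
    obtain ⟨h1, h2⟩ := hsub hh
    have hs : 0 ≤ h - h₀ := (sub_pos.2 h1.1).le
    have h3 := hC δ hδ _ h2
    simp only [sub_zero, Real.mul_rpow hl.le hs] at h3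
    rw [hMM h h1 δ hδ]
    have h4 : σ * l⁻¹ * M' (l * (h - h₀)) δ - (h - h₀) ^ (((p : ℝ) + 1) / (2 * p)) *
        ∑ j ∈ Finset.range N, σ * l ^ ((1 + 2 * (j : ℝ) - p) / (2 * p)) * B j δ *
          (h - h₀) ^ ((j : ℝ) / p) =
        σ * l⁻¹ * (M' (l * (h - h₀)) δ -
          l ^ (((p : ℝ) + 1) / (2 * p)) * (h - h₀) ^ (((p : ℝ) + 1) / (2 * p)) *
          ∑ j ∈ Finset.range N, B j δ * (l ^ ((j : ℝ) / p) * (h - h₀) ^ ((j : ℝ) / p))) := by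
      rw [mul_sub (σ * l⁻¹), Finset.mul_sum, Finset.mul_sum, Finset.mul_sum]
      congr 1
      refine Finset.sum_congr rfl fun j _ => ?_
      rw [hexp]
      ring
    rw [h4, abs_mul, abs_mul, abs_of_pos (inv_pos.2 hl)]
    refine (mul_le_mul_of_nonneg_left h3 (by positivity)).trans_eq ?_
    ring
  · obtain ⟨r, hr, hC⟩ := hM.2 hA
    refine ⟨min r₀ (r / l), lt_min hr₀ (div_pos hr hl), fun δ hδ h hh => ?_⟩
    obtain ⟨h1, h2⟩ := hsub hh
    have hs : 0 ≤ h - h₀ := (sub_pos.2 h1.1).le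
    obtain ⟨S, hS, hMS⟩ := hC δ hδ _ h2
    simp only [sub_zero, Real.mul_rpow hl.le hs] at hS hMS
    refine ⟨σ * l⁻¹ * l ^ (((p : ℝ) + 1) / (2 * p)) * S, ?_, ?_⟩
    · refine (hS.mul_left (σ * l⁻¹ * l ^ (((p : ℝ) + 1) / (2 * p)))).congr_fun fun j => ?_
      simp only [hexp]
      ring
    · rw [hMM h h1 δ hδ, hMS]
      ring

/-- In a normal form, `F(0, v) = (κ/2) v² + O(v³)`. -/
theorem IsCenterNormalForm.isBigO {F : ℝ × ℝ → ℝ} {p : ℕ} (hF : IsCenterNormalForm F p) :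
    ∃ κ : ℝ, 0 < κ ∧ (fun v : ℝ => F (0, v) - κ / 2 * v ^ 2) =O[𝓝 0] fun v => v ^ 3 := by
  obtain ⟨⟨κ, hκ, h⟩, -⟩ := hF
  have ht : Tendsto (fun v : ℝ => ((0 : ℝ), v)) (𝓝 0) (𝓝 0) :=
    (Continuous.prodMk continuous_const continuous_id).tendsto 0
  have hn : (fun v : ℝ => ‖((0 : ℝ), v)‖ ^ 3) =O[𝓝 0] fun v : ℝ => v ^ 3 := by
    refine isBigO_of_le _ fun v => ?_
    simp [Prod.norm_def]
  refine ⟨κ, hκ, ?_⟩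
  -- On the `v`-axis the term in `u²` vanishes, so the two normal forms agree there.
  rcases h with h | h
  · have h1 := (IsBigO.comp_tendsto h ht).trans hn
    simpa [Function.comp_def] using h1
  · exact (IsBigO.comp_tendsto h ht).trans hn

/-- The normal form forces `D / k > 0`. -/
theorem div_pos_of_isCenterNormalForm {a b c d k x₀ y₀ : ℝ} {H : ℝ × ℝ → ℝ}
    (hH : ContDiff ℝ ∞ H) (L : CenterFamily H (x₀, y₀)) (hD : a * d - b * c ≠ 0) (hk : k ≠ 0)
    {p : ℕ} (hp : 1 ≤ p) (hnf : IsCenterNormalForm (newH a b c d k x₀ y₀ H) p) :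
    0 < (a * d - b * c) / k := by
  obtain ⟨κ, hκ, hO⟩ := hnf.isBigO
  have hF : ContDiff ℝ ∞ (newH a b c d k x₀ y₀ H) :=
    contDiff_const.mul ((hH.comp contDiff_oldCoords).sub contDiff_const)
  obtain ⟨X, Y, Φ, -, -, -, -, -, hev⟩ :=
    exists_normal_coordinates (Or.inl rfl) hF.contDiffAt hκ hO hp hnf.2
  -- The new Hamiltonian is `X^{2p} + Y² ≥ 0`, whereas `H > h₀` on the orbits, which fill a
  -- punctured neighbourhood. Comparing the two at one point fixes the sign of `D/k`.
  have h1 : ∀ᶠ w in 𝓝[≠] (0 : ℝ × ℝ), 0 ≤ newH a b c d k x₀ y₀ H w :=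
    nhdsWithin_le_nhds (hev.mono fun w hw => by
      rw [hw.1]
      exact add_nonneg ((even_two_mul p).pow_nonneg _) (sq_nonneg _))
  have h2 : ∀ᶠ w in 𝓝[≠] (0 : ℝ × ℝ), H (x₀, y₀) < H (oldCoords a b c d x₀ y₀ w) := by
    have h3 : oldCoords a b c d x₀ y₀ ⁻¹' _ ∈ 𝓝 ((0, 0) : ℝ × ℝ) :=
      continuous_oldCoords.continuousAt.preimage_mem_nhds (by
        rw [oldCoords_zero]; exact L.fills)
    filter_upwards [nhdsWithin_le_nhds h3, self_mem_nhdsWithin] with w hw hw0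
    rcases hw with hw | hw
    · refine absurd ?_ hw0
      rw [mem_singleton_iff, ← newCoords_oldCoords (x₀ := x₀) (y₀ := y₀) hD w, hw, newCoords_center]
      rfl
    · simp only [mem_iUnion] at hw
      obtain ⟨h, hh, t, ht⟩ := hw
      rw [← ht, (L.isPeriodicOrbit h hh).level]
      exact hh.1
  obtain ⟨w, hw1, hw2⟩ := (h1.and h2).exists
  refine lt_of_le_of_ne (not_lt.1 fun hneg => ?_) (div_ne_zero hD hk).symm
  have := mul_neg_of_neg_of_pos hneg (sub_pos.2 hw2)
  simp only [newH] at hw1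
  linarith

end NearHamiltonian

theorem theorem6 {m : ℕ} (H : ℝ × ℝ → ℝ) (P Q : ℝ × ℝ → EuclideanSpace ℝ (Fin m) → ℝ)
    (Δ V : Set (EuclideanSpace ℝ (Fin m))) (hΔ : IsCompact Δ) (hV : IsOpen V) (hΔV : Δ ⊆ V)
    (hH : ContDiff ℝ ∞ H)
    (hP : ContDiffOn ℝ ∞ (fun w : (ℝ × ℝ) × EuclideanSpace ℝ (Fin m) => P w.1 w.2) (univ ×ˢ V))
    (hQ : ContDiffOn ℝ ∞ (fun w : (ℝ × ℝ) × EuclideanSpace ℝ (Fin m) => Q w.1 w.2) (univ ×ˢ V))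
    (x₀ y₀ h₀ : ℝ) (hh₀ : H (x₀, y₀) = h₀)
    (L : NearHamiltonian.CenterFamily H (x₀, y₀))
    (a b c d D k : ℝ) (hD : D = a * d - b * c) (hD0 : D ≠ 0) (hk : k ≠ 0)
    (p : ℕ) (hp : 1 ≤ p)
    (hnf : NearHamiltonian.IsCenterNormalForm (NearHamiltonian.newH a b c d k x₀ y₀ H) p) :
    Nonempty (NearHamiltonian.CenterFamily (NearHamiltonian.newH a b c d k x₀ y₀ H) (0, 0)) ∧
    ∃ B : ℕ → EuclideanSpace ℝ (Fin m) → ℝ,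
      (∀ L' : NearHamiltonian.CenterFamily (NearHamiltonian.newH a b c d k x₀ y₀ H) (0, 0),
        NearHamiltonian.IsExpansion
          (NearHamiltonian.IsAnalyticSystem H P Q (x₀, y₀) Δ)
          (fun s => s ^ (((p : ℝ) + 1) / (2 * p))) (fun j s => s ^ ((j : ℝ) / p)) 0 Δ
          (L'.melnikov (NearHamiltonian.newP a b c d k x₀ y₀ P Q)
            (NearHamiltonian.newQ a b c d k x₀ y₀ P Q))
          B) ∧
      NearHamiltonian.IsExpansion
        (NearHamiltonian.IsAnalyticSystem H P Q (x₀, y₀) Δ)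
        (fun s => s ^ (((p : ℝ) + 1) / (2 * p))) (fun j s => s ^ ((j : ℝ) / p)) h₀ Δ
        (L.melnikov P Q)
        (fun j δ => Real.sign k * (D / k) ^ ((1 + 2 * (j : ℝ) - p) / (2 * p)) * B j δ) ∧
      (p = 1 →
        NearHamiltonian.IsExpansion
          (NearHamiltonian.IsAnalyticSystem H P Q (x₀, y₀) Δ)
          (fun s => s) (fun j s => s ^ j) h₀ Δ
          (L.melnikov P Q)
          (fun j δ => Real.sign k * (D / k) ^ j * B j δ)) := by
  open NearHamiltonian in
  subst hD hh₀
  have hDk := div_pos_of_isCenterNormalForm hH L hD0 hk hp hnf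
  have hHd : Differentiable ℝ H := hH.differentiable (by simp)
  let L₁ := L.transform hD0 hk hDk hHd
  refine ⟨⟨L₁⟩, ?_⟩
  -- the common regularity class of the system
  obtain ⟨n, hn, hA, hHn, hPn, hQn⟩ : ∃ n : WithTop ℕ∞, (n = ∞ ∨ n = ω) ∧
      (IsAnalyticSystem H P Q (x₀, y₀) Δ → n = ω) ∧ ContDiffAt ℝ n H (x₀, y₀) ∧
      (∀ δ ∈ Δ, ContDiffAt ℝ n
        (fun w : (ℝ × ℝ) × EuclideanSpace ℝ (Fin m) => P w.1 w.2) ((x₀, y₀), δ)) ∧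
      ∀ δ ∈ Δ, ContDiffAt ℝ n
        (fun w : (ℝ × ℝ) × EuclideanSpace ℝ (Fin m) => Q w.1 w.2) ((x₀, y₀), δ) := by
    by_cases hA : IsAnalyticSystem H P Q (x₀, y₀) Δ
    · exact ⟨ω, Or.inr rfl, fun _ => rfl, hA.1.contDiffAt, fun δ hδ => (hA.2 δ hδ).1.contDiffAt,
        fun δ hδ => (hA.2 δ hδ).2.contDiffAt⟩
    · have hmem : ∀ δ ∈ Δ, (univ ×ˢ V : Set ((ℝ × ℝ) × EuclideanSpace ℝ (Fin m))) ∈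
          𝓝 ((x₀, y₀), δ) := fun δ hδ => (isOpen_univ.prod hV).mem_nhds ⟨mem_univ _, hΔV hδ⟩
      exact ⟨∞, Or.inl rfl, fun h => absurd h hA, hH.contDiffAt,
        fun δ hδ => hP.contDiffAt (hmem δ hδ), fun δ hδ => hQ.contDiffAt (hmem δ hδ)⟩
  obtain ⟨κ, hκ, hO⟩ := hnf.isBigO
  have hFn : ContDiffAt ℝ n (newH a b c d k x₀ y₀ H) 0 := by
    refine contDiffAt_const.mul (ContDiffAt.sub ?_ contDiffAt_const)
    refine ContDiffAt.comp (g := H) (0 : ℝ × ℝ) ?_ contDiff_oldCoords.contDiffAt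
    rw [← Prod.mk_zero_zero, oldCoords_zero]
    exact hHn
  have hcomp : ∀ {G : ℝ × ℝ → EuclideanSpace ℝ (Fin m) → ℝ} {δ : EuclideanSpace ℝ (Fin m)},
      ContDiffAt ℝ n (fun w : (ℝ × ℝ) × EuclideanSpace ℝ (Fin m) => G w.1 w.2) ((x₀, y₀), δ) →
      ContDiffAt ℝ n (fun w : (ℝ × ℝ) × EuclideanSpace ℝ (Fin m) =>
        G (oldCoords a b c d x₀ y₀ w.1) w.2) (0, δ) := fun {G δ} hG => by
    refine ContDiffAt.comp
      (g := fun w : (ℝ × ℝ) × EuclideanSpace ℝ (Fin m) => G w.1 w.2)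
      (f := fun w : (ℝ × ℝ) × EuclideanSpace ℝ (Fin m) => (oldCoords a b c d x₀ y₀ w.1, w.2))
      (0, δ) ?_ ((contDiff_oldCoords.contDiffAt.comp _ contDiffAt_fst).prodMk contDiffAt_snd)
    rw [← Prod.mk_zero_zero, oldCoords_zero]
    exact hG
  obtain ⟨S, hS, hSe, hSM⟩ := exists_melnikov_eq hn hFn hκ hO hp hnf.2 hΔ
    (P := newP a b c d k x₀ y₀ P Q) (Q := newQ a b c d k x₀ y₀ P Q)
    (fun δ hδ => contDiffAt_const.mul ((contDiffAt_const.mul (hcomp (hPn δ hδ))).add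
      (contDiffAt_const.mul (hcomp (hQn δ hδ)))))
    (fun δ hδ => contDiffAt_const.mul ((contDiffAt_const.mul (hcomp (hPn δ hδ))).add
      (contDiffAt_const.mul (hcomp (hQn δ hδ)))))
  -- `S` was obtained before any family of orbits was chosen, so the same coefficients serve every
  -- `L'`, in particular the image `L₁` of `L`.
  have hexp : ∀ L' : CenterFamily (newH a b c d k x₀ y₀ H) (0, 0),
      IsExpansion (IsAnalyticSystem H P Q (x₀, y₀) Δ)
        (fun s => s ^ (((p : ℝ) + 1) / (2 * p))) (fun j s => s ^ ((j : ℝ) / p)) 0 Δ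
        (L'.melnikov (newP a b c d k x₀ y₀ P Q) (newQ a b c d k x₀ y₀ P Q)) (evenCoeff S) :=
    fun L' =>
      have h := isExpansion_of_even hn hΔ hS hSe hp (hSM L')
      ⟨h.1, fun hAn => h.2 (hA hAn)⟩
  have hmain := (hexp L₁).rescale hp L.β_pos hDk
    (fun h hh δ _ => L.melnikov_transform hD0 hk hDk hHd P Q hh δ)
  refine ⟨evenCoeff S, hexp, hmain, ?_⟩
  rintro rfl
  have e1 : (fun s : ℝ => s ^ ((((1 : ℕ) : ℝ) + 1) / (2 * ((1 : ℕ) : ℝ)))) = fun s => s := by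
    ext s
    norm_num
  have e2 : (fun (j : ℕ) (s : ℝ) => s ^ ((j : ℝ) / ((1 : ℕ) : ℝ))) = fun j s => s ^ j := by
    ext j s
    simp
  have e3 : (fun (j : ℕ) (δ : EuclideanSpace ℝ (Fin m)) => Real.sign k * ((a * d - b * c) / k) ^
      ((1 + 2 * (j : ℝ) - ((1 : ℕ) : ℝ)) / (2 * ((1 : ℕ) : ℝ))) * evenCoeff S j δ) =
      fun j δ => Real.sign k * ((a * d - b * c) / k) ^ j * evenCoeff S j δ := by
    ext j δ
    have : (1 + 2 * (j : ℝ) - ((1 : ℕ) : ℝ)) / (2 * ((1 : ℕ) : ℝ)) = j := by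
      push_cast
      ring
    rw [this, Real.rpow_natCast]
  rw [e1, e2, e3] at hmain
  exact hmain

end
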